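/- Let $k$ be an algebraically closed field, $N$ a lattice (a free abelian group of finite rank), $M=\operatorname{Hom}(N,\mathbb{Z})$, and $\sigma\subset N_{\mathbb{R}}=\mathbb{R}\otimes_{\mathbb{Z}}N$ a strongly convex rational polyhedral cone. Put $\sigma_M=\{m\in M : \langle m,n\rangle\ge 0 \text{ for all } n\in\sigma\}$, let $k[\sigma_M]=\bigoplus_{m\in\sigma_M}k\cdot\chi(m)$ be its semigroup ring, $U_\sigma=\operatorname{Spec}k[\sigma_M]$ the associated affine toric variety, and $T=\operatorname{Spec}k[M]$ the torus, acting on $U_\sigma$ by $a:T\times U_\sigma\to U_\sigma$ with $a^{*}\chi(m)=\chi(m)\otimes\chi(m)$. Then the following three categories are equivalent: (i) $T$-equivariant quasicoherent sheaves on $U_\sigma$: pairs $(\mathcal{E},\Phi)$ of a quasicoherent sheaf $\mathcal{E}$ on $U_\sigma$ and an isomorphism $\Phi:a^{*}\mathcal{E}\to p_2^{*}\mathcal{E}$ on $T\times U_\sigma$ (where $p_2$ is the projection to $U_\sigma$) satisfying $p_{23}^{*}\Phi\circ(1\times a)^{*}\Phi=(\mu\times 1)^{*}\Phi$ on $T\times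 T\times U_\sigma$ (where $p_{23}$ is the projection to the last two factors and $\mu$ is the multiplication of $T$); morphisms are the morphisms of sheaves of modules that commute with the isomorphisms $\Phi$; (ii) $M$-graded $k[\sigma_M]$-modules, that is, modules $E$ with a decomposition $E=\bigoplus_{m\in M}E_m$ into additive subgroups such that $k\chi(m)\cdot E_{m'}\subseteq E_{m+m'}$ for all $m\in\sigma_M$, $m'\in M$, with homogeneous homomorphisms of degree $0$, that is, $k[\sigma_M]$-linear maps $f:E\to F$ such that $f(E_m)\subseteq F_m$ for all $m\in M$; (iii) $\sigma$-families: families $(E_m)_{m\in M}$ of $k$-vector spaces with a linear map $\chi_{m,m'}:E_m\to E_{m'}$ for each relation $m\le_\sigma m'$ (meaning $m'-m\in\sigma_M$), such that $\chi_{m,m}=\mathrm{id}$ and $\chi_{m,m''}=\chi_{m',m''}\circ\chi_{m,m'}$ whenever $m\le_\sigma m'\le_\sigma m''$; a morphism to a $\sigma$-family $(F_m)$ with maps $\psi_{m,m'}$ is a family of linear maps $\phi_m:E_m\to F_m$ with $\phi_{m'}\circ\chi_{m,m'}=\psi_{m,m'}\circ\phi_m$ for all $m\le_\sigma m'$. 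-/

import Mathlib

open CategoryTheory AlgebraicGeometry MonoidalCategory CartesianMonoidalCategory Opposite
open scoped TensorProduct MonObj

universe u

noncomputable section

/-! ### Pulling back morphisms between inverse images of sheaves of modules -/

/-- For a morphism `φ : f^* E ⟶ f'^* F` of sheaves of modules on `Y` and `g : Z ⟶ Y`, the morphism
`g^* φ`, regarded as a morphism `h^* E ⟶ h'^* F` where `h = f ∘ g` and `h' = f' ∘ g`, by means
of the canonical isomorphisms `g^* f^* ≅ (f ∘ g)^*`. -/
def pullbackModulesHom {X X' Y Z : Scheme.{u}} {f : Y ⟶ X} {f' : Y ⟶ X'}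
    {E : X.Modules} {F : X'.Modules}
    (φ : (Scheme.Modules.pullback f).obj E ⟶ (Scheme.Modules.pullback f').obj F)
    (g : Z ⟶ Y) {h : Z ⟶ X} {h' : Z ⟶ X'} (hf : g ≫ f = h) (hf' : g ≫ f' = h') :
    (Scheme.Modules.pullback h).obj E ⟶ (Scheme.Modules.pullback h').obj F :=
  (Scheme.Modules.pullbackCongr hf).inv.app E ≫
    (Scheme.Modules.pullbackComp g f).inv.app E ≫
    (Scheme.Modules.pullback g).map φ ≫
    (Scheme.Modules.pullbackComp g f').hom.app F ≫
    (Scheme.Modules.pullbackCongr hf').hom.app F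

/-! ### Equivariant quasicoherent sheaves -/

section Equivariant

variable {S : Scheme.{u}} (G X : Over S) [GrpObj G]

/-- `(g, g', x) ↦ (g g', x)`. -/
def mulIdHom : G ⊗ (G ⊗ X) ⟶ G ⊗ X := (α_ G G X).inv ≫ μ[G] ▷ X

/-- `(g, g', x) ↦ x`. -/
def sndSndHom : G ⊗ (G ⊗ X) ⟶ X := snd G (G ⊗ X) ≫ snd G X

lemma mulIdHom_snd : mulIdHom G X ≫ snd G X = sndSndHom G X := by
  simp [mulIdHom, sndSndHom]

variable [ModObj G X]

/-- The action `a : G × X ⟶ X`, `(g, x) ↦ g x`, of a group scheme on a scheme over `S`. -/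
def actHom : G ⊗ X ⟶ X := γ[G, X]

/-- `(g, g', x) ↦ (g, g' x)`. -/
def idActHom : G ⊗ (G ⊗ X) ⟶ G ⊗ X := G ◁ actHom G X

/-- `(g, g', x) ↦ g g' x`. -/
def actActHom : G ⊗ (G ⊗ X) ⟶ X := idActHom G X ≫ actHom G X

/-- `(g, g', x) ↦ g' x`. -/
def sndActHom : G ⊗ (G ⊗ X) ⟶ X := snd G (G ⊗ X) ≫ actHom G X

lemma idActHom_snd : idActHom G X ≫ snd G X = sndActHom G X := by
  simp [idActHom, sndActHom]

lemma mulIdHom_act : mulIdHom G X ≫ actHom G X = actActHom G X := by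
  simp only [mulIdHom, actHom, actActHom, idActHom, Category.assoc]
  exact (ModObj.assoc_flip (M := G) X).symm

/-- A `G`-linearized (`G`-equivariant) quasicoherent sheaf on `X`: a quasicoherent sheaf of
modules `E` with an isomorphism `Φ : a^* E ≅ p₂^* E` on `G × X` (over a point `g` of `G`
this is an isomorphism `Φ_g : g^* E ≅ E`) such that
`p₂₃^* Φ ∘ (1 × a)^* Φ = (m × 1)^* Φ` on `G × G × X`
(over points `g, g'` this says `Φ_{g'} ∘ g'^* Φ_g = Φ_{g g'}`). -/
structure EquivariantQCoh where
  sheaf : X.left.Modules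
  isQuasicoherent : sheaf.IsQuasicoherent
  Φ : (Scheme.Modules.pullback (actHom G X).left).obj sheaf ≅
    (Scheme.Modules.pullback (snd G X).left).obj sheaf
  cocycle :
    pullbackModulesHom Φ.hom (idActHom G X).left
        (h := (actActHom G X).left) (h' := (sndActHom G X).left)
        rfl (by rw [← idActHom_snd]; rfl) ≫
      pullbackModulesHom Φ.hom (snd G (G ⊗ X)).left
        (h := (sndActHom G X).left) (h' := (sndSndHom G X).left) rfl rfl =
    pullbackModulesHom Φ.hom (mulIdHom G X).left
        (h := (actActHom G X).left) (h' := (sndSndHom G X).left)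
        (by rw [← mulIdHom_act]; rfl) (by rw [← mulIdHom_snd]; rfl)

namespace EquivariantQCoh

variable {G X}

/-- Morphisms of equivariant sheaves: morphisms of sheaves of modules that commute with the
linearizations. -/
@[ext]
structure Hom (E F : EquivariantQCoh G X) where
  hom : E.sheaf ⟶ F.sheaf
  comm : E.Φ.hom ≫ (Scheme.Modules.pullback (snd G X).left).map hom =
    (Scheme.Modules.pullback (actHom G X).left).map hom ≫ F.Φ.hom

instance : Category (EquivariantQCoh G X) where
  Hom := Hom
  id E := ⟨𝟙 E.sheaf, by simp⟩
  comp f g := ⟨f.hom ≫ g.hom, by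
    rw [Functor.map_comp, ← Category.assoc, f.comm, Category.assoc, g.comm, Functor.map_comp,
      Category.assoc]⟩

end EquivariantQCoh

end Equivariant

/-! ### Cones and their dual semigroups -/

section Cones

variable {N : Type u} [AddCommGroup N]

/-- A strongly convex rational polyhedral cone in `N_ℝ = ℝ ⊗ N`: generated by finitely many
lattice vectors and containing no line. -/
structure IsToricCone (σ : PointedCone ℝ (ℝ ⊗[ℤ] N)) : Prop where
  rational_polyhedral :
    ∃ s : Finset N, σ = PointedCone.hull ℝ ((fun n : N ↦ (1 : ℝ) ⊗ₜ[ℤ] n) '' (s : Set N))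
  strongly_convex : (σ : ConvexCone ℝ (ℝ ⊗[ℤ] N)).Salient

/-- The real linear extension `⟨m, ·⟩ : N_ℝ → ℝ` of `m ∈ M = Hom(N, ℤ)`. -/
def realPairing (m : Module.Dual ℤ N) : (ℝ ⊗[ℤ] N) →ₗ[ℝ] ℝ :=
  LinearMap.liftBaseChange ℝ (Algebra.linearMap ℤ ℝ ∘ₗ m)

/-- The semigroup `σ_M`: all `m ∈ M` with `⟨m, n⟩ ≥ 0` for all `n ∈ σ`. -/
def dualSemigroup (σ : PointedCone ℝ (ℝ ⊗[ℤ] N)) : AddSubmonoid (Module.Dual ℤ N) where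
  carrier := {m | ∀ n ∈ σ, 0 ≤ realPairing m n}
  zero_mem' n _ := by simp [realPairing]
  add_mem' {a b} ha hb n hn := by
    have : realPairing (a + b) n = realPairing a n + realPairing b n := by
      simp [realPairing, LinearMap.comp_add, ← LinearMap.add_apply, ← map_add]
    rw [this]
    exact add_nonneg (ha n hn) (hb n hn)

end Cones

/-! ### Affine group scheme actions from coactions -/

section Coaction

/-- A monoidal functor takes module objects to module objects. -/
@[reducible]
def modObjMap {C D : Type*} [Category C] [MonoidalCategory C] [Category D] [MonoidalCategory D]
    (F : C ⥤ D) [F.LaxMonoidal] (M X : C) [MonObj M] [ModObj M X] :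
    letI := F.monObjObj M
    ModObj (F.obj M) (F.obj X) :=
  letI := F.monObjObj M
  { smul := Functor.LaxMonoidal.μ F M X ≫ F.map γ[M, X]
    one_smul := by
      change (Functor.LaxMonoidal.ε F ≫ F.map η[M]) ▷ F.obj X ≫
        Functor.LaxMonoidal.μ F M X ≫ F.map γ[M, X] = (λ_ (F.obj X)).hom
      have h : η[M] ▷ X ≫ γ[M, X] = (λ_ X).hom := ModObj.one_smul (M := M) X
      simp [← F.map_comp, h]
    mul_smul := by
      change (Functor.LaxMonoidal.μ F M M ≫ F.map μ[M]) ▷ F.obj X ≫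
        Functor.LaxMonoidal.μ F M X ≫ F.map γ[M, X] =
        (α_ (F.obj M) (F.obj M) (F.obj X)).hom ≫
          F.obj M ◁ (Functor.LaxMonoidal.μ F M X ≫ F.map γ[M, X]) ≫
          Functor.LaxMonoidal.μ F M X ≫ F.map γ[M, X]
      have h : μ[M] ▷ X ≫ γ[M, X] = (α_ M M X).hom ≫ M ◁ γ[M, X] ≫ γ[M, X] :=
        ModObj.mul_smul (M := M) X
      simp only [comp_whiskerRight, MonoidalCategory.whiskerLeft_comp, Category.assoc,
        Functor.LaxMonoidal.μ_natural_left_assoc, Functor.LaxMonoidal.μ_natural_right_assoc,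
        ← F.map_comp, h]
      simp }

variable {R H A : CommRingCat.{u}} [HopfAlgebra R H] [Algebra R A]

/-- A coaction of a Hopf algebra on an algebra, as an action in the opposite category of
commutative algebras. -/
@[reducible]
def coactionModObj (ρ : A →ₐ[R] H ⊗[R] A)
    (counit : ∀ a, Algebra.TensorProduct.map (Bialgebra.counitAlgHom R H) (AlgHom.id R A) (ρ a) =
      (1 : R) ⊗ₜ[R] a)
    (coassoc : ∀ a, Algebra.TensorProduct.map (Bialgebra.comulAlgHom R H) (AlgHom.id R A) (ρ a) =
      (Algebra.TensorProduct.assoc R R R H H A).symm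
        (Algebra.TensorProduct.map (AlgHom.id R H) ρ (ρ a))) :
    ModObj (op (CommAlgCat.of R H)) (op (CommAlgCat.of R A)) where
  smul := (CommAlgCat.ofHom ρ).op
  one_smul := by
    apply Quiver.Hom.unop_inj
    apply CommAlgCat.hom_ext
    apply AlgHom.ext
    exact counit
  mul_smul := by
    apply Quiver.Hom.unop_inj
    apply CommAlgCat.hom_ext
    apply AlgHom.ext
    exact coassoc

/-- The action of the group scheme `Spec H` on `Spec A` over `Spec R` given by a coaction. -/
@[reducible]
def specModObj (ρ : A →ₐ[R] H ⊗[R] A)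
    (counit : ∀ a, Algebra.TensorProduct.map (Bialgebra.counitAlgHom R H) (AlgHom.id R A) (ρ a) =
      (1 : R) ⊗ₜ[R] a)
    (coassoc : ∀ a, Algebra.TensorProduct.map (Bialgebra.comulAlgHom R H) (AlgHom.id R A) (ρ a) =
      (Algebra.TensorProduct.assoc R R R H H A).symm
        (Algebra.TensorProduct.map (AlgHom.id R H) ρ (ρ a))) :
    ModObj ((Spec H).asOver (Spec R)) ((Spec A).asOver (Spec R)) :=
  letI := coactionModObj ρ counit coassoc
  letI m := modObjMap (algSpec R) (op (CommAlgCat.of R H)) (op (CommAlgCat.of R A))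
  { smul := m.smul
    one_smul := m.one_smul
    mul_smul := m.mul_smul }

lemma specModObj_smul_left (ρ : A →ₐ[R] H ⊗[R] A) (counit) (coassoc) :
    (specModObj ρ counit coassoc).smul.left =
      (pullbackSpecIso R H A).hom ≫ Spec.map (CommRingCat.ofHom ρ.toRingHom) := rfl

end Coaction

/-! ### The torus and the affine toric variety -/

section Toric

variable (k : Type u) [Field k] {N : Type u} [AddCommGroup N]

/-- The coordinate ring `k[σ_M]`. -/
abbrev CoordRing (σ : PointedCone ℝ (ℝ ⊗[ℤ] N)) : Type u :=
  AddMonoidAlgebra k (dualSemigroup σ)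

variable (N) in
/-- The torus `T = Spec k[M]`, a group scheme over `k`. -/
abbrev torus : Over (Spec (CommRingCat.of k)) :=
  (Spec (CommRingCat.of (AddMonoidAlgebra k (Module.Dual ℤ N)))).asOver (Spec (CommRingCat.of k))

/-- The affine toric variety `U_σ = Spec k[σ_M]`. -/
abbrev affineToric (σ : PointedCone ℝ (ℝ ⊗[ℤ] N)) : Over (Spec (CommRingCat.of k)) :=
  (Spec (CommRingCat.of (CoordRing k σ))).asOver (Spec (CommRingCat.of k))

/-- The coaction `k[σ_M] → k[M] ⊗ k[σ_M]`, `χ(m) ↦ χ(m) ⊗ χ(m)`. -/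
def torusCoaction (σ : PointedCone ℝ (ℝ ⊗[ℤ] N)) :
    CoordRing k σ →ₐ[k] AddMonoidAlgebra k (Module.Dual ℤ N) ⊗[k] CoordRing k σ :=
  AddMonoidAlgebra.lift k _ (dualSemigroup σ)
    { toFun := fun m ↦ AddMonoidAlgebra.single (m.toAdd : Module.Dual ℤ N) (1 : k) ⊗ₜ[k]
        AddMonoidAlgebra.single m.toAdd (1 : k)
      map_one' := rfl
      map_mul' := fun m m' ↦ by
        simp [AddMonoidAlgebra.single_mul_single] }

lemma torusCoaction_single (σ : PointedCone ℝ (ℝ ⊗[ℤ] N)) (m : dualSemigroup σ) :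
    torusCoaction k σ (AddMonoidAlgebra.single m 1) =
      AddMonoidAlgebra.single (m : Module.Dual ℤ N) (1 : k) ⊗ₜ[k]
        AddMonoidAlgebra.single m (1 : k) := by
  simp [torusCoaction]

lemma torusCoaction_counit (σ : PointedCone ℝ (ℝ ⊗[ℤ] N)) (a : CoordRing k σ) :
    Algebra.TensorProduct.map (Bialgebra.counitAlgHom k _) (AlgHom.id k _)
      (torusCoaction k σ a) = (1 : k) ⊗ₜ[k] a := by
  induction a using AddMonoidAlgebra.induction_linear with
  | zero => simp
  | add f g hf hg => rw [map_add, map_add, hf, hg, TensorProduct.tmul_add]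
  | single m r =>
    have h : (AddMonoidAlgebra.single m r : CoordRing k σ) =
        r • AddMonoidAlgebra.single m 1 := by simp
    rw [h, map_smul, map_smul, torusCoaction_single, TensorProduct.tmul_smul]
    simp

lemma torusCoaction_coassoc (σ : PointedCone ℝ (ℝ ⊗[ℤ] N)) (a : CoordRing k σ) :
    Algebra.TensorProduct.map (Bialgebra.comulAlgHom k _) (AlgHom.id k _)
      (torusCoaction k σ a) =
    (Algebra.TensorProduct.assoc k k k _ _ _).symm
      (Algebra.TensorProduct.map (AlgHom.id k _) (torusCoaction k σ) (torusCoaction k σ a)) := by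
  induction a using AddMonoidAlgebra.induction_linear with
  | zero => simp
  | add f g hf hg => rw [map_add, map_add, map_add, map_add, hf, hg]
  | single m r =>
    have h : (AddMonoidAlgebra.single m r : CoordRing k σ) =
        r • AddMonoidAlgebra.single m 1 := by simp
    rw [h, map_smul, map_smul, map_smul, map_smul, torusCoaction_single]
    simp [torusCoaction_single]

/-- The action of the torus `T` on `U_σ`, given by the coaction `χ(m) ↦ χ(m) ⊗ χ(m)`. -/
instance torusAction (σ : PointedCone ℝ (ℝ ⊗[ℤ] N)) : ModObj (torus k N) (affineToric k σ) :=
  specModObj (R := CommRingCat.of k) (H := CommRingCat.of (AddMonoidAlgebra k (Module.Dual ℤ N)))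
    (A := CommRingCat.of (CoordRing k σ)) (torusCoaction k σ)
    (torusCoaction_counit k σ) (torusCoaction_coassoc k σ)

lemma torusAction_left (σ : PointedCone ℝ (ℝ ⊗[ℤ] N)) :
    (actHom (torus k N) (affineToric k σ)).left =
      (pullbackSpecIso k (AddMonoidAlgebra k (Module.Dual ℤ N)) (CoordRing k σ)).hom ≫
        Spec.map (CommRingCat.ofHom (torusCoaction k σ).toRingHom) := rfl

/-! ### `M`-graded modules over `k[σ_M]` -/

open scoped Classical in
/-- An `M`-graded `k[σ_M]`-module: a module `E` with additive subgroups `E_m`, `m ∈ M`, such that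
`E = ⨁ E_m` and `k[σ_M]_m · E_m' ⊆ E_(m + m')`, where `k[σ_M]_m` is spanned by `χ(m)` if
`m ∈ σ_M` and is zero otherwise. -/
structure GradedMod (σ : PointedCone ℝ (ℝ ⊗[ℤ] N)) where
  carrier : ModuleCat.{u} (CoordRing k σ)
  component : Module.Dual ℤ N → AddSubgroup carrier
  gradedSMul : SetLike.GradedSMul
    (AddMonoidAlgebra.gradeBy k (Subtype.val : dualSemigroup σ → Module.Dual ℤ N)) component
  isInternal : DirectSum.IsInternal component

namespace GradedMod

variable {k} {σ : PointedCone ℝ (ℝ ⊗[ℤ] N)}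

/-- Homomorphisms of degree `0`. -/
@[ext]
structure Hom (E F : GradedMod k σ) where
  hom : E.carrier ⟶ F.carrier
  map_mem : ∀ (m : Module.Dual ℤ N) (e : E.carrier), e ∈ E.component m → hom e ∈ F.component m

instance : Category (GradedMod k σ) where
  Hom := Hom
  id E := ⟨𝟙 E.carrier, fun _ _ h ↦ h⟩
  comp f g := ⟨f.hom ≫ g.hom, fun m e h ↦ g.map_mem m _ (f.map_mem m e h)⟩

end GradedMod

/-! ### `σ`-families -/

/-- The lattice `M`, preordered by `m ≤_σ m'` iff `m' - m ∈ σ_M`. -/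
def CharLattice (_σ : PointedCone ℝ (ℝ ⊗[ℤ] N)) : Type u := Module.Dual ℤ N

instance (σ : PointedCone ℝ (ℝ ⊗[ℤ] N)) : AddCommGroup (CharLattice σ) :=
  inferInstanceAs (AddCommGroup (Module.Dual ℤ N))

instance (σ : PointedCone ℝ (ℝ ⊗[ℤ] N)) : Preorder (CharLattice σ) where
  le m m' := m' - m ∈ dualSemigroup σ
  le_refl m := by
    rw [sub_self]
    exact (dualSemigroup σ).zero_mem
  le_trans m m' m'' h h' := by
    have e : m'' - m' + (m' - m) = m'' - m := sub_add_sub_cancel _ _ _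
    exact Eq.subst (motive := (· ∈ dualSemigroup σ)) e ((dualSemigroup σ).add_mem h' h)

/-- A `σ`-family: vector spaces `E_m`, `m ∈ M`, with linear maps `χ_(m, m') : E_m → E_m'` for
`m ≤_σ m'` such that `χ_(m, m) = 1` and `χ_(m, m'') = χ_(m', m'') ∘ χ_(m, m')`, that is, a functor
from the preordered set `M` to vector spaces. Morphisms are families of linear maps
`E_m → F_m` commuting with the structure maps, that is, natural transformations. -/
abbrev SigmaFamily (σ : PointedCone ℝ (ℝ ⊗[ℤ] N)) := CharLattice σ ⥤ ModuleCat.{u} k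

end Toric

end

/-!
The equivalence of graded modules and `σ`-families is elementary: a graded module `E` gives the
family of its components `E_m`, with multiplication by `χ(m' - m)` as the map `E_m → E_m'`
(`sigmaFamilyFunctor`), and a `σ`-family is recovered from the `k[σ_M]`-module `⨁ F_m`
(`SigmaFamily.toGradedMod`).

For equivariant sheaves the point is that a linearization is a coaction. As `U_σ` is affine, a
quasicoherent sheaf `E` on it is the same as the module of its global sections, and morphisms out of
an inverse image `f^* E` are the same as semilinear maps out of `Γ(E)` (`pullback_hom_ext`,
`exists_pullback_hom`). So `Φ : a^* E ≅ p₂^* E` amounts to the map `x ↦ Φ(a^* x)` from `Γ(E)` to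
`Γ(p₂^* E)`. The functions on `T × U_σ` are free over those on `U_σ`, and the characters `χ(m)` form
a basis; hence every section of `p₂^* E` is uniquely a sum `∑ χ(m) • p₂^* x_m`
(`bijective_sum_smul_pullbackSection`), and likewise on `T × T × U_σ` with products of two
characters. Comparing coefficients in the cocycle condition shows that the coefficients of `Φ(a^*
x)` are homogeneous, `Φ(a^* x_m) = χ(m) • p₂^* x_m` (`coaction_coassoc`). Restriction to the unit of
`T` shows that `x ↦ Φ(a^* x)` is injective, and it follows that `x = ∑ x_m`. Thus `Γ(E)` is the
direct sum of its weight spaces `{x | Φ(a^* x) = χ(m) • p₂^* x}` (`isInternal_weightSpace`), and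
this grading is compatible with that of `k[σ_M]` because `a^* χ(m) = χ(m) ⊗ χ(m)`.

This defines the functor `gradedSectionsFunctor`. It is fully faithful because a morphism of sheaves
commutes with the linearizations if and only if it preserves weights. It is essentially surjective
because a grading of `Γ(E)` yields a linearization with `Φ(a^* x) = χ(m) • p₂^* x` for `x` of degree
`m`, whose inverse is given by `χ(-m)` in place of `χ(m)` (`exists_linearization`); the cocycle
condition holds as it can be checked on homogeneous sections (`pullbackModulesHom_cocycle`).
-/

noncomputable section

/-! ### Inverse images of global sections -/

section Sections

variable {X Y Z : Scheme.{u}}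

/-- The inverse image `f^* x ∈ Γ(Z, f^* E)` of a global section `x ∈ Γ(X, E)`: the unit of the
adjunction `f^* ⊣ f_*` on global sections. -/
def pullbackSection (f : Z ⟶ X) (E : X.Modules) :
    Γ(E, ⊤) →+ Γ((Scheme.Modules.pullback f).obj E, ⊤) :=
  (((Scheme.Modules.pullbackPushforwardAdjunction f).unit.app E).app ⊤).hom

lemma pullbackSection_smul (f : Z ⟶ X) (E : X.Modules) (r : Γ(X, ⊤)) (x : Γ(E, ⊤)) :
    pullbackSection f E (r • x) = f.appTop r • pullbackSection f E x :=
  Scheme.Modules.Hom.app_smul ((Scheme.Modules.pullbackPushforwardAdjunction f).unit.app E) r x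

lemma pullback_map_pullbackSection (f : Z ⟶ X) {E F : X.Modules} (φ : E ⟶ F) (x : Γ(E, ⊤)) :
    ((Scheme.Modules.pullback f).map φ).app ⊤ (pullbackSection f E x) =
      pullbackSection f F (φ.app ⊤ x) := by
  have := (Scheme.Modules.pullbackPushforwardAdjunction f).unit.naturality φ
  have := congr(Scheme.Modules.Hom.app $this ⊤)
  exact (congr($this x)).symm

lemma pullbackComp_hom_pullbackSection (g : Z ⟶ Y) (f : Y ⟶ X) (E : X.Modules) (x : Γ(E, ⊤)) :
    ((Scheme.Modules.pullbackComp g f).hom.app E).app ⊤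
      (pullbackSection g _ (pullbackSection f E x)) = pullbackSection (g ≫ f) E x := by
  have h := unit_conjugateEquiv ((Scheme.Modules.pullbackPushforwardAdjunction f).comp
    (Scheme.Modules.pullbackPushforwardAdjunction g))
      (Scheme.Modules.pullbackPushforwardAdjunction (g ≫ f))
      (Scheme.Modules.pullbackComp g f).inv E
  rw [Scheme.Modules.conjugateEquiv_pullbackComp_inv] at h
  have h1 := congr(Scheme.Modules.Hom.app $h ⊤ x)
  have h2 : pullbackSection g _ (pullbackSection f E x) =
    ((Scheme.Modules.pullbackComp g f).inv.app E).app ⊤ (pullbackSection (g ≫ f) E x) := h1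
  rw [h2, ← ConcreteCategory.comp_apply, ← Scheme.Modules.Hom.comp_app, Iso.inv_hom_id_app]
  rfl

lemma pullbackCongr_hom_pullbackSection {f f' : Z ⟶ X} (h : f = f') (E : X.Modules)
    (x : Γ(E, ⊤)) :
    ((Scheme.Modules.pullbackCongr h).hom.app E).app ⊤ (pullbackSection f E x) =
      pullbackSection f' E x := by
  subst h
  rfl

lemma pullbackId_hom_pullbackSection (E : X.Modules) (x : Γ(E, ⊤)) :
    ((Scheme.Modules.pullbackId X).hom.app E).app ⊤ (pullbackSection (𝟙 X) E x) = x := by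
  have h := unit_conjugateEquiv .id (Scheme.Modules.pullbackPushforwardAdjunction (𝟙 X))
      (Scheme.Modules.pullbackId X).hom E
  rw [Scheme.Modules.conjugateEquiv_pullbackId_hom] at h
  exact congr(Scheme.Modules.Hom.app $h ⊤ x).symm

/-! ### Quasicoherent sheaves on affine schemes and their inverse images -/

section Spec

variable {A : CommRingCat.{u}} {E G : (Spec A).Modules} [E.IsQuasicoherent]

lemma Spec_modules_hom_ext {φ ψ : E ⟶ G} (h : ∀ x : Γ(E, ⊤), φ.app ⊤ x = ψ.app ⊤ x) :
    φ = ψ := by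
  have hn (χ : E ⟶ G) := (tilde.adjunction (R := A)).counit.naturality χ
  have : IsIso ((tilde.adjunction (R := A)).counit.app E) :=
    inferInstanceAs (IsIso E.fromTildeΓ)
  rw [← cancel_epi ((tilde.adjunction (R := A)).counit.app E)]
  refine (hn φ).symm.trans (Eq.trans ?_ (hn ψ))
  have : moduleSpecΓFunctor.map φ = moduleSpecΓFunctor.map ψ := by
    ext x
    exact h x
  simp only [Functor.comp_map, this]

/-- Every linear map on the global sections of a quasicoherent sheaf on an affine scheme comes from
a morphism of sheaves of modules. -/
lemma exists_Spec_modules_hom (d : Γ(E, ⊤) →+ Γ(G, ⊤))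
    (hd : ∀ (r : Γ(Spec A, ⊤)) x, d (r • x) = r • d x) :
    ∃ φ : E ⟶ G, ∀ x, φ.app ⊤ x = d x := by
  have : IsIso ((tilde.adjunction (R := A)).counit.app E) :=
    inferInstanceAs (IsIso E.fromTildeΓ)
  let d' : moduleSpecΓFunctor.obj E ⟶ moduleSpecΓFunctor.obj G :=
    ModuleCat.ofHom (R := A) (X := moduleSpecΓFunctor.obj E) (Y := moduleSpecΓFunctor.obj G)
      { toFun := d, map_add' := d.map_add, map_smul' := fun r x ↦ hd _ x }
  refine ⟨inv ((tilde.adjunction (R := A)).counit.app E) ≫ (tilde.functor A).map d' ≫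
    (tilde.adjunction (R := A)).counit.app G, fun x ↦ ?_⟩
  generalize hφ : inv ((tilde.adjunction (R := A)).counit.app E) ≫ (tilde.functor A).map d' ≫
    (tilde.adjunction (R := A)).counit.app G = φ
  rw [IsIso.inv_comp_eq] at hφ
  have hn := (tilde.adjunction (R := A)).counit.naturality φ
  have : moduleSpecΓFunctor.map φ = d' := by
    apply ((tilde.adjunction (R := A)).homEquiv _ _).symm.injective
    rw [Adjunction.homEquiv_counit, Adjunction.homEquiv_counit]
    exact hn.trans hφ.symm
  exact congr($this x)

variable {f : Z ⟶ Spec A} {F : Z.Modules}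

/-- A morphism out of the inverse image `f^* E` of a quasicoherent sheaf on an affine scheme is
determined by its values on the sections `f^* x`. -/
lemma pullback_hom_ext {φ ψ : (Scheme.Modules.pullback f).obj E ⟶ F}
    (h : ∀ x : Γ(E, ⊤), φ.app ⊤ (pullbackSection f E x) = ψ.app ⊤ (pullbackSection f E x)) :
    φ = ψ := by
  apply ((Scheme.Modules.pullbackPushforwardAdjunction f).homEquiv _ _).injective
  apply Spec_modules_hom_ext
  intro x
  rw [Adjunction.homEquiv_unit, Adjunction.homEquiv_unit]
  exact h x

/-- A map from the global sections of a quasicoherent sheaf `E` on an affine scheme that is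
semilinear along `f` comes from a morphism out of `f^* E`. -/
lemma exists_pullback_hom (d : Γ(E, ⊤) →+ Γ(F, ⊤))
    (hd : ∀ (r : Γ(Spec A, ⊤)) x, d (r • x) = f.appTop r • d x) :
    ∃ φ : (Scheme.Modules.pullback f).obj E ⟶ F, ∀ x, φ.app ⊤ (pullbackSection f E x) = d x := by
  obtain ⟨φ, hφ⟩ := exists_Spec_modules_hom (G := (Scheme.Modules.pushforward f).obj F) d hd
  refine ⟨((Scheme.Modules.pullbackPushforwardAdjunction f).homEquiv _ _).symm φ, fun x ↦ ?_⟩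
  obtain ⟨φ, rfl⟩ := ((Scheme.Modules.pullbackPushforwardAdjunction f).homEquiv _ _).surjective φ
  rw [Equiv.symm_apply_apply]
  refine Eq.trans ?_ (hφ x)
  rw [Adjunction.homEquiv_unit]
  rfl

end Spec

/-- The canonical isomorphism `g^* f^* F ≅ h^* F` for `h = f ∘ g`. -/
def pullbackPullbackIso (g : Z ⟶ Y) {f : Y ⟶ X} {h : Z ⟶ X} (hf : g ≫ f = h) (F : X.Modules) :
    (Scheme.Modules.pullback g).obj ((Scheme.Modules.pullback f).obj F) ≅
      (Scheme.Modules.pullback h).obj F :=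
  (Scheme.Modules.pullbackComp g f).app F ≪≫ (Scheme.Modules.pullbackCongr hf).app F

/-- `pullbackModulesHom φ g` is `g^* φ` up to the canonical isomorphisms `g^* f^* ≅ (f ∘ g)^*`. -/
lemma pullbackModulesHom_eq {X' : Scheme.{u}} {f : Y ⟶ X} {f' : Y ⟶ X'}
    {E : X.Modules} {F : X'.Modules}
    (φ : (Scheme.Modules.pullback f).obj E ⟶ (Scheme.Modules.pullback f').obj F)
    (g : Z ⟶ Y) {h : Z ⟶ X} {h' : Z ⟶ X'} (hf : g ≫ f = h) (hf' : g ≫ f' = h') :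
    (pullbackPullbackIso g hf E).hom ≫ pullbackModulesHom φ g hf hf' =
      (Scheme.Modules.pullback g).map φ ≫ (pullbackPullbackIso g hf' F).hom := by
  subst hf hf'
  rw [pullbackModulesHom, pullbackPullbackIso, pullbackPullbackIso]
  simp only [Iso.trans_hom, Iso.app_hom, Category.assoc, Iso.hom_inv_id_app_assoc]

lemma pullbackPullbackIso_hom_pullbackSection (g : Z ⟶ Y) {f : Y ⟶ X} {h : Z ⟶ X}
    (hf : g ≫ f = h) (F : X.Modules) (x : Γ(F, ⊤)) :
    (pullbackPullbackIso g hf F).hom.app ⊤ (pullbackSection g _ (pullbackSection f F x)) =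
      pullbackSection h F x := by
  subst hf
  exact (congrArg _ (pullbackComp_hom_pullbackSection g f F x)).trans
    (pullbackCongr_hom_pullbackSection rfl F x)

/-- The canonical isomorphism `g^* f^* F ≅ F` for `f ∘ g = 1`. -/
def pullbackPullbackIsoId (g : X ⟶ Y) {f : Y ⟶ X} (hf : g ≫ f = 𝟙 X) (F : X.Modules) :
    (Scheme.Modules.pullback g).obj ((Scheme.Modules.pullback f).obj F) ≅ F :=
  pullbackPullbackIso g hf F ≪≫ (Scheme.Modules.pullbackId X).app F

lemma pullbackPullbackIsoId_hom_pullbackSection (g : X ⟶ Y) {f : Y ⟶ X} (hf : g ≫ f = 𝟙 X)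
    (F : X.Modules) (x : Γ(F, ⊤)) :
    (pullbackPullbackIsoId g hf F).hom.app ⊤ (pullbackSection g _ (pullbackSection f F x)) = x := by
  rw [pullbackPullbackIsoId, Iso.trans_hom, Scheme.Modules.Hom.comp_app,
    ConcreteCategory.comp_apply, pullbackPullbackIso_hom_pullbackSection]
  exact pullbackId_hom_pullbackSection F x

lemma pullbackSection_injective_of_section (g : Z ⟶ X) (s : X ⟶ Z) (h : s ≫ g = 𝟙 X)
    (E : X.Modules) : Function.Injective (pullbackSection g E) := by
  intro x y hxy
  rw [← pullbackPullbackIsoId_hom_pullbackSection s h E x, hxy,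
    pullbackPullbackIsoId_hom_pullbackSection]

lemma app_comp_apply {E F G : X.Modules} (φ : E ⟶ F) (ψ : F ⟶ G) (U : X.Opens) (x : Γ(E, U)) :
    (φ ≫ ψ).app U x = ψ.app U (φ.app U x) := rfl

lemma app_bijective {E F : X.Modules} (φ : E ⟶ F) [IsIso φ] :
    Function.Bijective (φ.app ⊤) := ConcreteCategory.bijective_of_isIso (φ.app ⊤)

lemma pullbackSection_bijective (g : Z ⟶ X) [IsIso g] (E : X.Modules) :
    Function.Bijective (pullbackSection g E) := by
  refine ⟨pullbackSection_injective_of_section g (inv g) (by simp) E, fun y ↦ ?_⟩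
  -- it suffices to treat an inverse image along `inv g`
  have h (F : Z.Modules) : Function.Surjective (pullbackSection g
      ((Scheme.Modules.pullback (inv g)).obj F)) := fun y ↦
    ⟨pullbackSection (inv g) F ((pullbackPullbackIsoId g (IsIso.hom_inv_id g) F).hom.app ⊤ y),
      (app_bijective (pullbackPullbackIsoId g (IsIso.hom_inv_id g) F).hom).1
        (pullbackPullbackIsoId_hom_pullbackSection _ _ _ _)⟩
  let e := (pullbackPullbackIsoId (inv g) (IsIso.inv_hom_id g) E).hom
  obtain ⟨z, hz⟩ := (app_bijective ((Scheme.Modules.pullback g).map e)).2 y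
  obtain ⟨x, rfl⟩ := h _ z
  exact ⟨e.app ⊤ x, by rw [← pullback_map_pullbackSection, hz]⟩

/-- The map on global sections of a morphism of sheaves of modules, as a linear map. -/
def appTopLinear {E F : X.Modules} (φ : E ⟶ F) : Γ(E, ⊤) →ₗ[Γ(X, ⊤)] Γ(F, ⊤) where
  toFun := φ.app ⊤
  map_add' := map_add _
  map_smul' r x := Scheme.Modules.Hom.app_smul φ r x

/-- Every module over `R` is the module of global sections of a quasicoherent sheaf on `Spec R`. -/
lemma exists_quasicoherent_addEquiv (R : CommRingCat.{u}) (Q : Type u) [AddCommGroup Q]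
    [Module R Q] : ∃ (T : (Spec R).Modules) (_ : T.IsQuasicoherent) (e : Q ≃+ Γ(T, ⊤)),
      ∀ (r : R) q, e (r • q) = (Scheme.ΓSpecIso R).inv r • e q :=
  ⟨tilde (ModuleCat.of R Q), inferInstance,
    (tilde.isoTop (ModuleCat.of R Q)).toLinearEquiv.toAddEquiv,
    fun r q ↦ (tilde.isoTop (ModuleCat.of R Q)).toLinearEquiv.map_smul r q⟩

lemma isoSpec_hom_appTop_ΓSpecIso_inv [IsAffine Z] (r : Γ(Z, ⊤)) :
    Z.isoSpec.hom.appTop ((Scheme.ΓSpecIso Γ(Z, ⊤)).inv r) = r := by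
  rw [← ConcreteCategory.comp_apply]
  simp [Scheme.isoSpec]

/-- On an affine scheme `Z`, every `Γ(Z, ⊤)`-module is the module of global sections of a sheaf of
modules `G` such that every linear map on global sections comes from a morphism out of `G`. -/
lemma exists_modules_linearMap_bijective [IsAffine Z] (Q : Type u) [AddCommGroup Q]
    [Module Γ(Z, ⊤) Q] :
    ∃ (G : Z.Modules) (j : Q →ₗ[Γ(Z, ⊤)] Γ(G, ⊤)), Function.Bijective j ∧
      ∀ (F : Z.Modules) (d : Q →ₗ[Γ(Z, ⊤)] Γ(F, ⊤)), ∃ ψ : G ⟶ F, appTopLinear ψ ∘ₗ j = d := by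
  obtain ⟨T, _, e, he⟩ := exists_quasicoherent_addEquiv Γ(Z, ⊤) Q
  let j : Q →ₗ[Γ(Z, ⊤)] Γ((Scheme.Modules.pullback Z.isoSpec.hom).obj T, ⊤) :=
    { toFun := fun q ↦ pullbackSection Z.isoSpec.hom T (e q)
      map_add' := fun x y ↦ by rw [map_add, map_add]
      map_smul' := fun r q ↦ by
        rw [he, pullbackSection_smul, isoSpec_hom_appTop_ΓSpecIso_inv, RingHom.id_apply] }
  have hj : Function.Bijective j := (pullbackSection_bijective _ T).comp e.bijective
  refine ⟨_, j, hj, fun F d ↦ ?_⟩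
  have hd (r : Γ(Spec Γ(Z, ⊤), ⊤)) (x : Γ(T, ⊤)) :
      d (e.symm (r • x)) = Z.isoSpec.hom.appTop r • d (e.symm x) := by
    obtain ⟨r, rfl⟩ := (Scheme.ΓSpecIso Γ(Z, ⊤)).commRingCatIsoToRingEquiv.symm.surjective r
    have h1 : e.symm ((Scheme.ΓSpecIso Γ(Z, ⊤)).inv r • x) = r • e.symm x := by
      rw [e.symm_apply_eq, he, e.apply_symm_apply]
    refine (congrArg d h1).trans ((d.map_smul r _).trans ?_)
    exact congrArg (· • d (e.symm x)) (isoSpec_hom_appTop_ΓSpecIso_inv r).symm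
  obtain ⟨ψ, hψ⟩ := exists_pullback_hom (f := Z.isoSpec.hom) (E := T) (F := F)
      (d.toAddMonoidHom.comp e.symm.toAddMonoidHom) hd
  refine ⟨ψ, LinearMap.ext fun q ↦ (hψ (e q)).trans ?_⟩
  exact congrArg d (e.symm_apply_apply q)

/-- If the functions on the affine scheme `Z` are free over those on `Spec A` with basis `b`, every
section of `f^* E` is uniquely `∑ b_i • f^* x_i` with `x_i ∈ Γ(E)`. This is the isomorphism
`Γ(f^* E) ≅ Γ(Z) ⊗ Γ(E)`; its inverse comes from the universal property of `f^* E`, which gives a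
morphism from `f^* E` to the sheaf associated with the tensor product. -/
lemma bijective_sum_smul_pullbackSection [IsAffine Z] {A : CommRingCat.{u}} (E : (Spec A).Modules)
    [E.IsQuasicoherent] (f : Z ⟶ Spec A) {I : Type*} (b : I → Γ(Z, ⊤))
    (hb : Function.Bijective fun c : I →₀ Γ(Spec A, ⊤) ↦ c.sum fun i a ↦ f.appTop a * b i) :
    Function.Bijective fun c : I →₀ Γ(E, ⊤) ↦ c.sum fun i e ↦ b i • pullbackSection f E e := by
  classical
  let : Algebra Γ(Spec A, ⊤) Γ(Z, ⊤) := f.appTop.hom.toAlgebra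
  let (F : Z.Modules) : Module Γ(Spec A, ⊤) Γ(F, ⊤) := Module.compHom _ f.appTop.hom
  have (F : Z.Modules) : IsScalarTower Γ(Spec A, ⊤) Γ(Z, ⊤) Γ(F, ⊤) :=
    .of_algebraMap_smul fun _ _ ↦ rfl
  let l : Γ(E, ⊤) →ₗ[Γ(Spec A, ⊤)] Γ((Scheme.Modules.pullback f).obj E, ⊤) :=
    { toFun := pullbackSection f E
      map_add' := map_add _
      map_smul' := pullbackSection_smul f E }
  let L := l.liftBaseChange Γ(Z, ⊤)
  have hL : Function.Bijective L := by
    obtain ⟨G, j, hj, hG⟩ := exists_modules_linearMap_bijective (Z := Z)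
      (Γ(Z, ⊤) ⊗[Γ(Spec A, ⊤)] Γ(E, ⊤))
    obtain ⟨ψ, hψ⟩ := hG _ L
    let d : Γ(E, ⊤) →ₗ[Γ(Spec A, ⊤)] Γ(G, ⊤) :=
      j.restrictScalars Γ(Spec A, ⊤) ∘ₗ TensorProduct.mk Γ(Spec A, ⊤) Γ(Z, ⊤) Γ(E, ⊤) 1
    obtain ⟨φ, hφ⟩ := exists_pullback_hom (f := f) (E := E) d.toAddMonoidHom d.map_smul
    have hψφ : φ ≫ ψ = 𝟙 _ := pullback_hom_ext fun x ↦ by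
      rw [Scheme.Modules.Hom.comp_app, ConcreteCategory.comp_apply, hφ]
      refine (LinearMap.congr_fun hψ _).trans ?_
      simp [L, l]
    have hφL : appTopLinear φ ∘ₗ L = j := by
      ext x
      simpa [L, l] using! hφ x
    have hφi : Function.Injective (appTopLinear φ) := fun x y hxy ↦ by
      have := congrArg (ψ.app ⊤) hxy
      change (φ ≫ ψ).app ⊤ x = (φ ≫ ψ).app ⊤ y at this
      rwa [hψφ] at this
    rw [← hφL, LinearMap.coe_comp] at hj
    exact ⟨hj.1.of_comp, hj.2.of_comp_left hφi⟩
  let bb : Module.Basis I Γ(Spec A, ⊤) Γ(Z, ⊤) := .ofRepr (LinearEquiv.ofBijective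
    (Finsupp.linearCombination Γ(Spec A, ⊤) b)
      (by
        convert hb using 1
        ext c
        simp [Finsupp.linearCombination_apply, Algebra.smul_def]
        rfl)).symm
  have hbb (i) : bb i = b i := by simp [bb]
  convert hL.comp (TensorProduct.equivFinsuppOfBasisLeft (N := Γ(E, ⊤)) bb).symm.bijective using 1
  ext c
  simp only [Function.comp_apply, TensorProduct.equivFinsuppOfBasisLeft_symm_apply, map_finsuppSum]
  simp [L, l, hbb]

/-- The inverse image of sections of `f^* F` along `g`, with values in the sections of `h^* F`,
where `h = f ∘ g`. -/
def pullbackSectionAlong (g : Z ⟶ Y) {f : Y ⟶ X} {h : Z ⟶ X} (hf : g ≫ f = h) (F : X.Modules) :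
    Γ((Scheme.Modules.pullback f).obj F, ⊤) →+ Γ((Scheme.Modules.pullback h).obj F, ⊤) :=
  ((pullbackPullbackIso g hf F).hom.app ⊤).hom.comp (pullbackSection g _)

lemma pullbackSectionAlong_smul (g : Z ⟶ Y) {f : Y ⟶ X} {h : Z ⟶ X} (hf : g ≫ f = h)
    (F : X.Modules) (r : Γ(Y, ⊤)) (y : Γ((Scheme.Modules.pullback f).obj F, ⊤)) :
    pullbackSectionAlong g hf F (r • y) = g.appTop r • pullbackSectionAlong g hf F y := by
  rw [pullbackSectionAlong, AddMonoidHom.comp_apply, AddMonoidHom.comp_apply, pullbackSection_smul]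
  exact Scheme.Modules.Hom.app_smul (pullbackPullbackIso g hf F).hom _ _

lemma pullbackSectionAlong_pullbackSection (g : Z ⟶ Y) {f : Y ⟶ X} {h : Z ⟶ X} (hf : g ≫ f = h)
    (F : X.Modules) (x : Γ(F, ⊤)) :
    pullbackSectionAlong g hf F (pullbackSection f F x) = pullbackSection h F x := by
  rw [pullbackSectionAlong, AddMonoidHom.comp_apply, ← pullbackPullbackIso_hom_pullbackSection g hf]

lemma pullbackModulesHom_pullbackSection {X' : Scheme.{u}} {f : Y ⟶ X} {f' : Y ⟶ X'}
    {E : X.Modules} {F : X'.Modules}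
    (φ : (Scheme.Modules.pullback f).obj E ⟶ (Scheme.Modules.pullback f').obj F)
    (g : Z ⟶ Y) {h : Z ⟶ X} {h' : Z ⟶ X'} (hf : g ≫ f = h) (hf' : g ≫ f' = h') (x : Γ(E, ⊤)) :
    (pullbackModulesHom φ g hf hf').app ⊤ (pullbackSection h E x) =
      pullbackSectionAlong g hf' F (φ.app ⊤ (pullbackSection f E x)) := by
  have h1 := congr(Scheme.Modules.Hom.app $(pullbackModulesHom_eq φ g hf hf') ⊤
    (pullbackSection g _ (pullbackSection f E x)))
  rw [app_comp_apply, app_comp_apply, pullbackPullbackIso_hom_pullbackSection,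
    pullback_map_pullbackSection] at h1
  rw [h1, pullbackSectionAlong, AddMonoidHom.comp_apply]

end Sections

/-! ### Gradings of abelian groups -/

section Gradings

variable {I V : Type*} [AddCommGroup V]

/-- The elements of weight `m` for a coaction `δ : V → ⨁ V`, to be thought of as
`x ↦ ∑ t^m ⊗ δ(x)_m`: those with `δ(x) = t^m ⊗ x`. -/
def weightSubgroup (δ : V →+ (I →₀ V)) (m : I) : AddSubgroup V where
  carrier := {x | δ x = Finsupp.single m x}
  zero_mem' := by simp
  add_mem' {x y} hx hy := by
    rw [Set.mem_ofPred_eq] at hx hy ⊢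
    rw [map_add, hx, hy, Finsupp.single_add]
  neg_mem' {x} hx := by
    rw [Set.mem_ofPred_eq] at hx ⊢
    rw [map_neg, hx, Finsupp.single_neg]

/-- A group with a coaction of the characters is the direct sum of its weight spaces: by
coassociativity the coefficients `δ(x)_m` of `δ(x)` have weight `m`, and their sum is `x` since `δ`
is injective and both have the same image. -/
lemma isInternal_weightSubgroup [DecidableEq I] (δ : V →+ (I →₀ V)) (hδ : Function.Injective δ)
    (hδ' : ∀ x m, δ (δ x m) = Finsupp.single m (δ x m)) :
    DirectSum.IsInternal (weightSubgroup δ) := by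
  refine ⟨(injective_iff_map_eq_zero _).mpr fun d hd ↦ ?_, fun x ↦ ?_⟩
  · have key (d : DirectSum I fun m ↦ weightSubgroup δ m) (m : I) :
        δ (DirectSum.coeAddMonoidHom (weightSubgroup δ) d) m = d m := by
      induction d using DirectSum.induction_on with
      | zero => simp
      | of i x =>
        rw [DirectSum.coeAddMonoidHom_of, show δ x = Finsupp.single i (x : V) from x.2,
          DirectSum.coe_of_apply, Finsupp.single_apply]
        split_ifs <;> rfl
      | add x y hx hy => simp [hx, hy]
    ext m
    rw [← key, hd]
    simp
  · refine ⟨(δ x).sum fun m v ↦ DirectSum.of (fun m ↦ weightSubgroup δ m) m ⟨δ x m, hδ' x m⟩,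
      hδ ?_⟩
    rw [map_finsuppSum, map_finsuppSum]
    simp only [DirectSum.coeAddMonoidHom_of, hδ']
    exact Finsupp.sum_single _

/-- The map `∑ t^j ⊗ y_j ↦ ∑ t^l ⊗ t^j ⊗ δ(y_j)_l`, that is, `δ` applied to the coefficients. -/
def pairCoefficients (δ : V →+ (I →₀ V)) : (I →₀ V) →+ (I × I →₀ V) :=
  Finsupp.liftAddHom fun j ↦ (Finsupp.liftAddHom fun l ↦ Finsupp.singleAddHom (l, j)).comp δ

/-- The map `∑ t^j ⊗ y_j ↦ ∑ t^j ⊗ t^j ⊗ y_j`, that is, the comultiplication of the characters. -/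
def diagonalCoefficients : (I →₀ V) →+ (I × I →₀ V) :=
  Finsupp.liftAddHom fun j ↦ Finsupp.singleAddHom (j, j)

lemma pairCoefficients_apply (δ : V →+ (I →₀ V)) (c : I →₀ V) (l j : I) :
    pairCoefficients δ c (l, j) = δ (c j) l := by
  classical
  induction c using Finsupp.induction_linear with
  | zero => simp
  | add c d hc hd => simp [hc, hd]
  | single j' y =>
    simp only [pairCoefficients, Finsupp.liftAddHom_apply_single, AddMonoidHom.comp_apply]
    rw [Finsupp.single_apply]
    split_ifs with h
    · subst h
      generalize δ y = c
      induction c using Finsupp.induction_linear with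
      | zero => simp
      | add c d hc hd => simp only [map_add, Finsupp.add_apply, hc, hd]
      | single l y => simp [Finsupp.single_apply]
    · generalize δ y = c
      rw [map_zero, Finsupp.zero_apply]
      induction c using Finsupp.induction_linear with
      | zero => simp
      | add c d hc hd => simp only [map_add, Finsupp.add_apply, hc, hd, add_zero]
      | single l y => simp [h]

lemma diagonalCoefficients_apply (c : I →₀ V) (l j : I) :
    diagonalCoefficients c (l, j) = Finsupp.single j (c j) l := by
  classical
  induction c using Finsupp.induction_linear with
  | zero => simp
  | add c d hc hd => simp [hc, hd]
  | single j' y =>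
    simp only [diagonalCoefficients, Finsupp.liftAddHom_apply_single, Finsupp.singleAddHom_apply,
      Finsupp.single_apply, Prod.mk.injEq]
    grind

/-- Coassociativity in terms of coefficients. Let the elements of `P` and of `G` have unique
expressions `∑ c_j(y_j)` and `∑ c'_{(l, j)}(y_{(l, j)})` with `y_j, y_{(l, j)} ∈ V`, and let
`ρ(x) = ∑ c_j(δ(x)_j)`. If `A` maps `c_j(y)` to `∑ c'_{(l, j)}(δ(y)_l)`, `B` maps `c_j(y)` to
`c'_{(j, j)}(y)` and `A ∘ ρ = B ∘ ρ`, then the coefficients of `x` are homogeneous: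
`δ(δ(x)_j)` is concentrated in degree `j`. -/
lemma coassoc_of_addMonoidHom {P G : Type*} [AddCommGroup P] [AddCommGroup G]
    (e : (I →₀ V) ≃+ P) (e' : (I × I →₀ V) ≃+ G) {c : I → V → P} {c' : I × I → V → G} {ρ : V → P}
    (δ : V →+ (I →₀ V)) (A B : P →+ G) (C : I → P →+ G)
    (he : ∀ j y, e (Finsupp.single j y) = c j y) (he' : ∀ j y, e' (Finsupp.single j y) = c' j y)
    (hδ : ∀ x, ρ x = e (δ x)) (hA : ∀ j y, A (c j y) = C j (ρ y))
    (hC : ∀ l j y, C j (c l y) = c' (l, j) y) (hB : ∀ j y, B (c j y) = c' (j, j) y)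
    (h : ∀ x, A (ρ x) = B (ρ x)) (x : V) (j : I) : δ (δ x j) = Finsupp.single j (δ x j) := by
  simp only [← he, ← he', hδ] at hA hB hC h
  have hA' : A.comp e.toAddMonoidHom = e'.toAddMonoidHom.comp (pairCoefficients δ) := by
    ext j y : 2
    simp only [AddMonoidHom.comp_apply, Finsupp.singleAddHom_apply, AddEquiv.coe_toAddMonoidHom,
      hA, pairCoefficients, Finsupp.liftAddHom_apply_single]
    generalize δ y = d
    induction d using Finsupp.induction_linear with
    | zero => simp
    | add d d' hd hd' => simp only [map_add, hd, hd']
    | single l y => simp [hC]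
  have hB' : B.comp e.toAddMonoidHom = e'.toAddMonoidHom.comp diagonalCoefficients := by
    ext j y : 2
    simp [hB, diagonalCoefficients]
  have hPQ : pairCoefficients δ (δ x) = diagonalCoefficients (δ x) :=
    e'.injective ((DFunLike.congr_fun hA' (δ x)).symm.trans
      ((h x).trans (DFunLike.congr_fun hB' (δ x))))
  ext l
  rw [← pairCoefficients_apply, ← diagonalCoefficients_apply, hPQ]

variable [DecidableEq I] {𝒱 : I → AddSubgroup V}

lemma DirectSum.IsInternal.exists_addMonoidHom_of_components (h : DirectSum.IsInternal 𝒱)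
    {G : Type*} [AddCommGroup G] (f : ∀ i, 𝒱 i →+ G) :
    ∃ d : V →+ G, ∀ m (x : 𝒱 m), d x = f m x := by
  let e := AddEquiv.ofBijective (DirectSum.coeAddMonoidHom 𝒱) h
  refine ⟨(DirectSum.toAddMonoid f).comp e.symm.toAddMonoidHom, fun m x ↦ ?_⟩
  have : e.symm x = DirectSum.of (fun m ↦ 𝒱 m) m x := by
    rw [e.symm_apply_eq]
    exact (DirectSum.coeAddMonoidHom_of 𝒱 m x).symm
  simp [this]

/-- A homomorphism out of a direct sum that agrees with `f i` on the `i`-th summand, for maps `f i`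
that are defined on the whole group. -/
lemma DirectSum.IsInternal.exists_addMonoidHom (h : DirectSum.IsInternal 𝒱) {G : Type*}
    [AddCommGroup G] (f : I → V →+ G) : ∃ d : V →+ G, ∀ m, ∀ x ∈ 𝒱 m, d x = f m x := by
  obtain ⟨d, hd⟩ := h.exists_addMonoidHom_of_components fun i ↦ (f i).comp (𝒱 i).subtype
  exact ⟨d, fun m x hx ↦ hd m ⟨x, hx⟩⟩

lemma DirectSum.IsInternal.induction_on (h : DirectSum.IsInternal 𝒱) {p : V → Prop}
    (h0 : p 0) (hadd : ∀ x y, p x → p y → p (x + y)) (hom : ∀ m, ∀ x ∈ 𝒱 m, p x) (x : V) : p x := by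
  obtain ⟨d, rfl⟩ := h.2 x
  induction d using DirectSum.induction_on with
  | zero => simpa
  | of i x => simpa using hom i _ x.2
  | add x y hx hy => simpa using hadd _ _ hx hy

/-- An injective homomorphism of degree `0` reflects homogeneity. -/
lemma DirectSum.IsInternal.mem_of_map_mem (h : DirectSum.IsInternal 𝒱) {W : Type*}
    [AddCommGroup W] {𝒲 : I → AddSubgroup W} (h' : DirectSum.IsInternal 𝒲) (f : V →+ W)
    (hf : Function.Injective f) (hfm : ∀ m, ∀ x ∈ 𝒱 m, f x ∈ 𝒲 m) {m : I} {x : V}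
    (hx : f x ∈ 𝒲 m) : x ∈ 𝒱 m := by
  -- the projections to the components of degree `m`
  obtain ⟨p, hp⟩ := h.exists_addMonoidHom fun i ↦ if i = m then .id V else 0
  obtain ⟨q, hq⟩ := h'.exists_addMonoidHom fun i ↦ if i = m then .id W else 0
  have hpm (x : V) : p x ∈ 𝒱 m := by
    induction x using h.induction_on with
    | h0 => simp
    | hadd x y hx hy => simpa using add_mem hx hy
    | hom i x hx =>
      rw [hp i x hx]
      split_ifs with hi
      · exact hi ▸ hx
      · simp
  have hpq (x : V) : q (f x) = f (p x) := by
    induction x using h.induction_on with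
    | h0 => simp
    | hadd x y hx hy => simp [hx, hy]
    | hom i x hx =>
      rw [hp i x hx, hq i _ (hfm i x hx)]
      split_ifs <;> simp
  have : f x = f (p x) := by rw [← hpq, hq m _ hx]; simp
  exact hf this ▸ hpm x

lemma DirectSum.isInternal_range {β : I → Type*} [∀ i, AddCommGroup (β i)] (f : ∀ i, β i →+ V)
    (h : Function.Bijective (DirectSum.toAddMonoid f)) :
    DirectSum.IsInternal fun i ↦ (f i).range := by
  have hf (i : I) : Function.Injective (f i) := fun x y hxy ↦
    DirectSum.of_injective i <| h.1 <| by rwa [DirectSum.toAddMonoid_of, DirectSum.toAddMonoid_of]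
  have hbij : Function.Bijective (DirectSum.map fun i ↦ (f i).rangeRestrict) :=
    ⟨(DirectSum.map_injective _).mpr fun i ↦ (f i).rangeRestrict_injective_iff.mpr (hf i),
      (DirectSum.map_surjective _).mpr fun i ↦ (f i).rangeRestrict_surjective⟩
  have hcomp : (DirectSum.coeAddMonoidHom fun i ↦ (f i).range).comp
      (DirectSum.map fun i ↦ (f i).rangeRestrict) = DirectSum.toAddMonoid f := by
    refine DirectSum.addHom_ext fun i x ↦ ?_
    rw [AddMonoidHom.comp_apply, DirectSum.map_of, DirectSum.coeAddMonoidHom_of,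
      DirectSum.toAddMonoid_of]
    rfl
  rw [← hcomp, AddMonoidHom.coe_comp] at h
  exact (Function.Bijective.of_comp_iff _ hbij).mp h

lemma DirectSum.IsInternal.map_addEquiv (h : DirectSum.IsInternal 𝒱) {W : Type*} [AddCommGroup W]
    (e : V ≃+ W) : DirectSum.IsInternal fun i ↦ (𝒱 i).map e.toAddMonoidHom := by
  have hcomp : DirectSum.toAddMonoid (fun i ↦ e.toAddMonoidHom.comp (𝒱 i).subtype) =
      e.toAddMonoidHom.comp (DirectSum.coeAddMonoidHom 𝒱) := by
    refine DirectSum.addHom_ext fun i x ↦ ?_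
    rw [AddMonoidHom.comp_apply, DirectSum.toAddMonoid_of, DirectSum.coeAddMonoidHom_of]
    rfl
  have hbij : Function.Bijective
      (DirectSum.toAddMonoid fun i ↦ e.toAddMonoidHom.comp (𝒱 i).subtype) := by
    rw [hcomp, AddMonoidHom.coe_comp]
    exact e.bijective.comp h
  convert DirectSum.isInternal_range _ hbij with i
  rw [AddMonoidHom.range_comp, AddSubgroup.range_subtype]

end Gradings

/-! ### The coaction on global sections given by a linearization -/

section Cocycle

/-- The homomorphism on global sections of a morphism of sheaves of modules. -/
def appTopHom {X : Scheme.{u}} {E F : X.Modules} (φ : E ⟶ F) : Γ(E, ⊤) →+ Γ(F, ⊤) :=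
  (φ.app ⊤).hom

lemma appTopHom_apply {X : Scheme.{u}} {E F : X.Modules} (φ : E ⟶ F) (x : Γ(E, ⊤)) :
    appTopHom φ x = φ.app ⊤ x := rfl

lemma appTopHom_smul {X : Scheme.{u}} {E F : X.Modules} (φ : E ⟶ F) (r : Γ(X, ⊤)) (x : Γ(E, ⊤)) :
    appTopHom φ (r • x) = r • appTopHom φ x := Scheme.Modules.Hom.app_smul φ r x

-- The names follow the case of a group `G` acting on `X`: there `Z = G × X` with the action `a` and
-- the projection `p` to `X`, and `W = G × G × X` with the maps `i = 1 × a`, `q = p₂₃` and `m = μ ×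
-- 1` to `Z` and the maps `aa`, `sa` and `ss` to `X`, which send `(g, g', x)` to `g g' x`, `g' x`
-- and `x`.
variable {X Z W : Scheme.{u}} {a p : Z ⟶ X} {i q m : W ⟶ Z} {aa sa ss : W ⟶ X} {E : X.Modules}
  (Φ : (Scheme.Modules.pullback a).obj E ⟶ (Scheme.Modules.pullback p).obj E)

/-- The coaction `x ↦ Φ(a^* x)` on global sections that belongs to `Φ : a^* E ⟶ p^* E`. -/
def coactionSection : Γ(E, ⊤) →+ Γ((Scheme.Modules.pullback p).obj E, ⊤) :=
  (appTopHom Φ).comp (pullbackSection a E)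

lemma coactionSection_apply (x : Γ(E, ⊤)) :
    coactionSection Φ x = appTopHom Φ (pullbackSection a E x) := by
  rw [coactionSection, AddMonoidHom.comp_apply]

lemma coactionSection_smul (r : Γ(X, ⊤)) (x : Γ(E, ⊤)) :
    coactionSection Φ (r • x) = a.appTop r • coactionSection Φ x := by
  rw [coactionSection_apply, coactionSection_apply, pullbackSection_smul, appTopHom_smul]

lemma coactionSection_injective [IsIso Φ] (s : X ⟶ Z) (h : s ≫ a = 𝟙 X) :
    Function.Injective (coactionSection Φ) :=
  (app_bijective Φ).1.comp (pullbackSection_injective_of_section a s h E)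

variable {I : Type*} {χ : I → Γ(Z, ⊤)} {s : I → Γ(W, ⊤)}

lemma appTopHom_comp {X : Scheme.{u}} {E F G : X.Modules} (φ : E ⟶ F) (ψ : F ⟶ G) (x : Γ(E, ⊤)) :
    appTopHom (φ ≫ ψ) x = appTopHom ψ (appTopHom φ x) := rfl

lemma appTopHom_map_pullbackSection {X Z : Scheme.{u}} (f : Z ⟶ X) {E F : X.Modules} (φ : E ⟶ F)
    (x : Γ(E, ⊤)) : appTopHom ((Scheme.Modules.pullback f).map φ) (pullbackSection f E x) =
      pullbackSection f F (appTopHom φ x) := by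
  rw [appTopHom_apply, appTopHom_apply, pullback_map_pullbackSection]

lemma appTopHom_pullbackModulesHom_pullbackSection {X X' Y Z : Scheme.{u}} {f : Y ⟶ X}
    {f' : Y ⟶ X'} {E : X.Modules} {F : X'.Modules}
    (φ : (Scheme.Modules.pullback f).obj E ⟶ (Scheme.Modules.pullback f').obj F)
    (g : Z ⟶ Y) {h : Z ⟶ X} {h' : Z ⟶ X'} (hf : g ≫ f = h) (hf' : g ≫ f' = h') (x : Γ(E, ⊤)) :
    appTopHom (pullbackModulesHom φ g hf hf') (pullbackSection h E x) =
      pullbackSectionAlong g hf' F (appTopHom φ (pullbackSection f E x)) := by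
  rw [appTopHom_apply, appTopHom_apply, pullbackModulesHom_pullbackSection]

/-- The left-hand side of the cocycle condition on the inverse image of a section. -/
lemma pullbackModulesHom_comp_pullbackSection (hia : i ≫ a = aa) (hip : i ≫ p = sa)
    (hqa : q ≫ a = sa) (hqp : q ≫ p = ss) (x : Γ(E, ⊤)) :
    appTopHom (pullbackModulesHom Φ i hia hip ≫ pullbackModulesHom Φ q hqa hqp)
        (pullbackSection aa E x) =
      appTopHom (pullbackModulesHom Φ q hqa hqp)
        (pullbackSectionAlong i hip E (coactionSection Φ x)) := by
  rw [appTopHom_comp, appTopHom_pullbackModulesHom_pullbackSection, coactionSection_apply]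

lemma pullbackModulesHom_pullbackSectionAlong_smul (hip : i ≫ p = sa)
    (hqa : q ≫ a = sa) (hqp : q ≫ p = ss) (r : Γ(Z, ⊤)) (x : Γ(E, ⊤)) :
    appTopHom (pullbackModulesHom Φ q hqa hqp)
        (pullbackSectionAlong i hip E (r • pullbackSection p E x)) =
      i.appTop r • pullbackSectionAlong q hqp E (coactionSection Φ x) := by
  rw [pullbackSectionAlong_smul, pullbackSectionAlong_pullbackSection, appTopHom_smul,
    appTopHom_pullbackModulesHom_pullbackSection, coactionSection_apply]

lemma pullbackSectionAlong_smul_pullbackSection (hqp : q ≫ p = ss) (r : Γ(Z, ⊤)) (x : Γ(E, ⊤)) :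
    pullbackSectionAlong q hqp E (r • pullbackSection p E x) =
      q.appTop r • pullbackSection ss E x := by
  rw [pullbackSectionAlong_smul, pullbackSectionAlong_pullbackSection]

/-- The cocycle condition makes the coaction coassociative. Here `χ_j ⊗ y` stands for
`χ_j • p^* y`, the isomorphism `e` expresses the sections of `p^* E` by coefficients in `Γ(E)`, the
isomorphism `e'` does the same for `ss^* E`, and `δ` is the coaction in terms of coefficients. -/
lemma coaction_coassoc
    (hia : i ≫ a = aa) (hip : i ≫ p = sa) (hqa : q ≫ a = sa) (hqp : q ≫ p = ss)
    (hma : m ≫ a = aa) (hmp : m ≫ p = ss)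
    (hΦ : pullbackModulesHom Φ i hia hip ≫ pullbackModulesHom Φ q hqa hqp =
      pullbackModulesHom Φ m hma hmp)
    (hm : ∀ j, m.appTop (χ j) = i.appTop (χ j) * q.appTop (χ j))
    (e : (I →₀ Γ(E, ⊤)) ≃+ Γ((Scheme.Modules.pullback p).obj E, ⊤))
    (he : ∀ j x, e (Finsupp.single j x) = χ j • pullbackSection p E x)
    (e' : (I × I →₀ Γ(E, ⊤)) ≃+ Γ((Scheme.Modules.pullback ss).obj E, ⊤))
    (he' : ∀ j x, e' (Finsupp.single j x) =
      (q.appTop (χ j.1) * i.appTop (χ j.2)) • pullbackSection ss E x)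
    (δ : Γ(E, ⊤) →+ (I →₀ Γ(E, ⊤))) (hδ : ∀ x, coactionSection Φ x = e (δ x))
    (x : Γ(E, ⊤)) (j : I) : δ (δ x j) = Finsupp.single j (δ x j) := by
  -- local names for the maps, since type checking would otherwise unfold the inverse images
  obtain ⟨c, hc⟩ : ∃ c : I → Γ(E, ⊤) → Γ((Scheme.Modules.pullback p).obj E, ⊤),
      ∀ j x, c j x = χ j • pullbackSection p E x := ⟨_, fun _ _ ↦ rfl⟩
  obtain ⟨c', hc'⟩ : ∃ c' : I × I → Γ(E, ⊤) → Γ((Scheme.Modules.pullback ss).obj E, ⊤),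
      ∀ j x, c' j x = (q.appTop (χ j.1) * i.appTop (χ j.2)) • pullbackSection ss E x :=
    ⟨_, fun _ _ ↦ rfl⟩
  obtain ⟨A, hA⟩ : ∃ A : Γ((Scheme.Modules.pullback p).obj E, ⊤) →+
      Γ((Scheme.Modules.pullback ss).obj E, ⊤), ∀ y, A y = appTopHom
        (pullbackModulesHom Φ q hqa hqp) (pullbackSectionAlong i hip E y) :=
    ⟨(appTopHom _).comp (pullbackSectionAlong i hip E), fun _ ↦ AddMonoidHom.comp_apply ..⟩
  obtain ⟨C, hC⟩ : ∃ C : I → Γ((Scheme.Modules.pullback p).obj E, ⊤) →+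
      Γ((Scheme.Modules.pullback ss).obj E, ⊤),
      ∀ j y, C j y = i.appTop (χ j) • pullbackSectionAlong q hqp E y :=
    ⟨fun j ↦ (DistribSMul.toAddMonoidHom _ (i.appTop (χ j))).comp (pullbackSectionAlong q hqp E),
      fun _ _ ↦ rfl⟩
  obtain ⟨B, hB⟩ : ∃ B, B = pullbackSectionAlong m hmp E := ⟨_, rfl⟩
  obtain ⟨ρ, hρ⟩ : ∃ ρ, ρ = coactionSection Φ := ⟨_, rfl⟩
  refine coassoc_of_addMonoidHom e e' δ A B C (c := c) (c' := c') (ρ := ρ) ?_ ?_ ?_ ?_ ?_ ?_ ?_ x j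
  · intro j y
    rw [he, hc]
  · intro j y
    rw [he', hc']
  · intro y
    rw [hρ, hδ]
  · intro j y
    rw [hA, hC, hc, hρ, pullbackModulesHom_pullbackSectionAlong_smul Φ hip hqa]
  · intro l j y
    rw [hC, hc, hc', pullbackSectionAlong_smul_pullbackSection, smul_smul, mul_comm]
  · intro j y
    rw [hB, hc, hc', pullbackSectionAlong_smul_pullbackSection, hm, mul_comm]
  · intro x
    rw [hA, hB, hρ, ← pullbackModulesHom_comp_pullbackSection Φ hia, hΦ,
      appTopHom_pullbackModulesHom_pullbackSection, coactionSection_apply]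

/-- The sections of weight `r`: the sections `x` with `Φ(a^* x) = r • p^* x`. -/
def weightSpace (r : Γ(Z, ⊤)) : AddSubgroup Γ(E, ⊤) where
  carrier := {x | coactionSection Φ x = r • pullbackSection p E x}
  zero_mem' := by simp
  add_mem' {x y} hx hy := by
    rw [Set.mem_ofPred_eq] at hx hy ⊢
    rw [map_add, hx, hy, map_add, smul_add]
  neg_mem' {x} hx := by
    rw [Set.mem_ofPred_eq] at hx ⊢
    rw [map_neg, hx, map_neg, smul_neg]

lemma mem_weightSpace {r : Γ(Z, ⊤)} {x : Γ(E, ⊤)} :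
    x ∈ weightSpace Φ r ↔ coactionSection Φ x = r • pullbackSection p E x := Iff.rfl

lemma smul_mem_weightSpace {r t : Γ(Z, ⊤)} {f : Γ(X, ⊤)} (hf : a.appTop f = t * p.appTop f)
    {x : Γ(E, ⊤)} (hx : x ∈ weightSpace Φ r) : f • x ∈ weightSpace Φ (t * r) := by
  rw [mem_weightSpace] at hx ⊢
  rw [coactionSection_smul, hx, pullbackSection_smul, hf, smul_smul, smul_smul]
  congr 1
  ring

/-- If the characters `χ j` give bases of the functions on `G × X` and on `G × G × X` over those on
`X`, the global sections of a linearized sheaf are the direct sum of the weight spaces. The section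
`t` of the action, given by the unit of `G`, makes the coaction injective. -/
lemma isInternal_weightSpace [DecidableEq I] [IsIso Φ] (t : X ⟶ Z) (ht : t ≫ a = 𝟙 X)
    (hia : i ≫ a = aa) (hip : i ≫ p = sa) (hqa : q ≫ a = sa) (hqp : q ≫ p = ss)
    (hma : m ≫ a = aa) (hmp : m ≫ p = ss)
    (hΦ : pullbackModulesHom Φ i hia hip ≫ pullbackModulesHom Φ q hqa hqp =
      pullbackModulesHom Φ m hma hmp)
    (hm : ∀ j, m.appTop (χ j) = i.appTop (χ j) * q.appTop (χ j))
    (e : (I →₀ Γ(E, ⊤)) ≃+ Γ((Scheme.Modules.pullback p).obj E, ⊤))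
    (he : ∀ j x, e (Finsupp.single j x) = χ j • pullbackSection p E x)
    (e' : (I × I →₀ Γ(E, ⊤)) ≃+ Γ((Scheme.Modules.pullback ss).obj E, ⊤))
    (he' : ∀ j x, e' (Finsupp.single j x) =
      (q.appTop (χ j.1) * i.appTop (χ j.2)) • pullbackSection ss E x) :
    DirectSum.IsInternal fun j ↦ weightSpace Φ (χ j) := by
  obtain ⟨δ, hδ⟩ : ∃ δ : Γ(E, ⊤) →+ (I →₀ Γ(E, ⊤)), ∀ x, coactionSection Φ x = e (δ x) :=
    ⟨e.symm.toAddMonoidHom.comp (coactionSection Φ), fun x ↦ (e.apply_symm_apply _).symm⟩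
  have h : weightSubgroup δ = fun j ↦ weightSpace Φ (χ j) := by
    ext j x
    rw [mem_weightSpace, hδ, ← he, e.injective.eq_iff]
    exact Iff.rfl
  rw [← h]
  refine isInternal_weightSubgroup δ (fun x y hxy ↦ ?_)
    (coaction_coassoc Φ hia hip hqa hqp hma hmp hΦ hm e he e' he' δ hδ)
  exact coactionSection_injective Φ t ht (by rw [hδ, hδ, hxy])

/-- The cocycle condition holds on sections whose weight is a character. -/
lemma pullbackModulesHom_cocycle_apply
    (hia : i ≫ a = aa) (hip : i ≫ p = sa) (hqa : q ≫ a = sa) (hqp : q ≫ p = ss)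
    (hma : m ≫ a = aa) (hmp : m ≫ p = ss) {r : Γ(Z, ⊤)}
    (hm : m.appTop r = i.appTop r * q.appTop r)
    {x : Γ(E, ⊤)} (hx : x ∈ weightSpace Φ r) :
    appTopHom (pullbackModulesHom Φ i hia hip ≫ pullbackModulesHom Φ q hqa hqp)
        (pullbackSection aa E x) =
      appTopHom (pullbackModulesHom Φ m hma hmp) (pullbackSection aa E x) := by
  rw [mem_weightSpace] at hx
  rw [pullbackModulesHom_comp_pullbackSection, hx, pullbackModulesHom_pullbackSectionAlong_smul, hx,
    pullbackSectionAlong_smul_pullbackSection, smul_smul, ← hm,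
    appTopHom_pullbackModulesHom_pullbackSection,
    ← pullbackSectionAlong_smul_pullbackSection hmp, ← hx, coactionSection_apply]

/-- If the global sections of `E` are a direct sum of weight spaces whose weights are characters,
the cocycle condition holds. -/
lemma pullbackModulesHom_cocycle [DecidableEq I]
    (hext : ∀ {φ ψ : (Scheme.Modules.pullback aa).obj E ⟶ (Scheme.Modules.pullback ss).obj E},
      (∀ x, appTopHom φ (pullbackSection aa E x) = appTopHom ψ (pullbackSection aa E x)) → φ = ψ)
    {𝒱 : I → AddSubgroup Γ(E, ⊤)} (h𝒱 : DirectSum.IsInternal 𝒱)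
    (hΦ : ∀ j, ∀ x ∈ 𝒱 j, x ∈ weightSpace Φ (χ j))
    (hia : i ≫ a = aa) (hip : i ≫ p = sa) (hqa : q ≫ a = sa) (hqp : q ≫ p = ss)
    (hma : m ≫ a = aa) (hmp : m ≫ p = ss)
    (hm : ∀ j, m.appTop (χ j) = i.appTop (χ j) * q.appTop (χ j)) :
    pullbackModulesHom Φ i hia hip ≫ pullbackModulesHom Φ q hqa hqp =
      pullbackModulesHom Φ m hma hmp :=
  hext fun x ↦ by
    induction x using h𝒱.induction_on with
    | h0 => simp only [map_zero]
    | hadd x y hx hy => simp only [map_add, hx, hy]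
    | hom j x hx =>
      exact pullbackModulesHom_cocycle_apply Φ hia hip hqa hqp hma hmp (hm j) (hΦ j x hx)

/-- Morphisms that commute with the linearizations preserve weights. -/
lemma map_mem_weightSpace {F : X.Modules}
    {Ψ : (Scheme.Modules.pullback a).obj F ⟶ (Scheme.Modules.pullback p).obj F} {φ : E ⟶ F}
    (h : Φ ≫ (Scheme.Modules.pullback p).map φ = (Scheme.Modules.pullback a).map φ ≫ Ψ)
    {r : Γ(Z, ⊤)} {x : Γ(E, ⊤)} (hx : x ∈ weightSpace Φ r) : appTopHom φ x ∈ weightSpace Ψ r := by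
  rw [mem_weightSpace, coactionSection_apply] at hx ⊢
  rw [← appTopHom_map_pullbackSection, ← appTopHom_map_pullbackSection, ← appTopHom_smul, ← hx,
    ← appTopHom_comp, ← appTopHom_comp, h]

/-- Morphisms that preserve weights commute with the linearizations. -/
lemma linearization_comm_apply {F : X.Modules}
    {Ψ : (Scheme.Modules.pullback a).obj F ⟶ (Scheme.Modules.pullback p).obj F} {φ : E ⟶ F}
    {r : Γ(Z, ⊤)} {x : Γ(E, ⊤)} (hx : x ∈ weightSpace Φ r) (hx' : appTopHom φ x ∈ weightSpace Ψ r) :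
    appTopHom (Φ ≫ (Scheme.Modules.pullback p).map φ) (pullbackSection a E x) =
      appTopHom ((Scheme.Modules.pullback a).map φ ≫ Ψ) (pullbackSection a E x) := by
  rw [mem_weightSpace, coactionSection_apply] at hx hx'
  rw [appTopHom_comp, hx, appTopHom_smul, appTopHom_comp, appTopHom_map_pullbackSection,
    appTopHom_map_pullbackSection, hx']

end Cocycle

/-! ### Weights of equivariant sheaves -/

section Equivariant

variable {S : Scheme.{u}} {G X : Over S} [GrpObj G] [ModObj G X] {I : Type*} [DecidableEq I]
  {χ : I → Γ((G ⊗ X).left, ⊤)}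

/-- The unit section `x ↦ (1, x)` is a section of the action. -/
lemma unitSection_comp_act : ((λ_ X).inv ≫ η[G] ▷ X) ≫ actHom G X = 𝟙 X := by
  have h : η[G] ▷ X ≫ γ[G, X] = (λ_ X).hom := ModObj.one_smul (M := G) X
  rw [Category.assoc, actHom, h, Iso.inv_hom_id]

lemma EquivariantQCoh.isInternal_weightSpace (E : EquivariantQCoh G X)
    (hm : ∀ j, (mulIdHom G X).left.appTop (χ j) =
      (idActHom G X).left.appTop (χ j) * (snd G (G ⊗ X)).left.appTop (χ j))
    (e : (I →₀ Γ(E.sheaf, ⊤)) ≃+ Γ((Scheme.Modules.pullback (snd G X).left).obj E.sheaf, ⊤))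
    (he : ∀ j x, e (Finsupp.single j x) = χ j • pullbackSection (snd G X).left E.sheaf x)
    (e' : (I × I →₀ Γ(E.sheaf, ⊤)) ≃+
      Γ((Scheme.Modules.pullback (sndSndHom G X).left).obj E.sheaf, ⊤))
    (he' : ∀ j x, e' (Finsupp.single j x) = ((snd G (G ⊗ X)).left.appTop (χ j.1) *
      (idActHom G X).left.appTop (χ j.2)) • pullbackSection (sndSndHom G X).left E.sheaf x) :
    DirectSum.IsInternal fun j ↦ weightSpace E.Φ.hom (χ j) :=
  _root_.isInternal_weightSpace E.Φ.hom ((λ_ X).inv ≫ η[G] ▷ X).left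
    (by rw [← Over.comp_left, unitSection_comp_act, Over.id_left]) rfl _ rfl rfl _ _ E.cocycle hm
    e he e' he'

/-- A quasicoherent sheaf whose global sections are a direct sum of weight spaces for an isomorphism
`Φ : a^* E ≅ p₂^* E` underlies an equivariant sheaf `F`. The identity `Γ(E) = Γ(F)` is stated as an
isomorphism `e`, which makes it possible to forget how `F` is defined. -/
lemma EquivariantQCoh.exists_of_weights (E : X.left.Modules) (hE : E.IsQuasicoherent)
    (Φ : (Scheme.Modules.pullback (actHom G X).left).obj E ≅
      (Scheme.Modules.pullback (snd G X).left).obj E)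
    {𝒱 : I → AddSubgroup Γ(E, ⊤)} (h𝒱 : DirectSum.IsInternal 𝒱)
    (hΦ : ∀ j, ∀ x ∈ 𝒱 j, x ∈ weightSpace Φ.hom (χ j))
    (hm : ∀ j, (mulIdHom G X).left.appTop (χ j) =
      (idActHom G X).left.appTop (χ j) * (snd G (G ⊗ X)).left.appTop (χ j))
    (hext : ∀ {Z : Scheme.{u}} {f : Z ⟶ X.left} {F : Z.Modules}
      {φ ψ : (Scheme.Modules.pullback f).obj E ⟶ F},
      (∀ x, appTopHom φ (pullbackSection f E x) = appTopHom ψ (pullbackSection f E x)) → φ = ψ) :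
    ∃ (F : EquivariantQCoh G X) (e : Γ(E, ⊤) ≃+ Γ(F.sheaf, ⊤)),
      (∀ (r : Γ(X.left, ⊤)) x, e (r • x) = r • e x) ∧
        ∀ j, ∀ x ∈ 𝒱 j, e x ∈ weightSpace F.Φ.hom (χ j) :=
  ⟨⟨E, hE, Φ, pullbackModulesHom_cocycle Φ.hom hext h𝒱 hΦ _ _ _ _ _ _ hm⟩, .refl _,
    fun _ _ ↦ rfl, hΦ⟩

end Equivariant

/-! ### Bases along ring homomorphisms -/

/-- `b` is a basis of `S` as a module over `R` along the ring homomorphism `f : R → S`. In contrast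
to `Module.Basis`, no algebra structure is needed, so that this applies to maps of schemes. -/
def IsBasisAlong {R S I : Type*} [CommRing R] [CommRing S] (f : R →+* S) (b : I → S) : Prop :=
  Function.Bijective fun c : I →₀ R ↦ c.sum fun i a ↦ f a * b i

namespace IsBasisAlong

variable {R S T I J : Type*} [CommRing R] [CommRing S] [CommRing T]

lemma iff_exists_basis [Algebra R S] {b : I → S} :
    IsBasisAlong (algebraMap R S) b ↔ ∃ b' : Module.Basis I R S, ⇑b' = b := by
  have h : (fun c : I →₀ R ↦ c.sum fun i a ↦ algebraMap R S a * b i) =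
      Finsupp.linearCombination R b := by
    ext c
    simp [Finsupp.linearCombination_apply, Algebra.smul_def]
  rw [IsBasisAlong, h]
  refine ⟨fun hb ↦ ⟨.ofRepr (LinearEquiv.ofBijective _ hb).symm, ?_⟩, ?_⟩
  · ext i
    simp
  · rintro ⟨b', rfl⟩
    convert b'.repr.symm.bijective using 1
    ext c
    simp

/-- In a tower `R → S → T` the products of basis elements form a basis. -/
lemma trans {f : R →+* S} {g : S →+* T} {b : I → S} {c : J → T} (hb : IsBasisAlong f b)
    (hc : IsBasisAlong g c) : IsBasisAlong (g.comp f) fun p : I × J ↦ g (b p.1) * c p.2 := by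
  let := f.toAlgebra
  let := g.toAlgebra
  let := (g.comp f).toAlgebra
  have : IsScalarTower R S T := .of_algebraMap_eq' rfl
  obtain ⟨b, rfl⟩ := iff_exists_basis.mp hb
  obtain ⟨c, rfl⟩ := iff_exists_basis.mp hc
  refine iff_exists_basis.mpr ⟨b.smulTower c, ?_⟩
  ext p
  rw [Module.Basis.smulTower_apply, Algebra.smul_def]
  rfl

lemma comp_equiv {R' S' : Type*} [CommRing R'] [CommRing S'] {f : R →+* S} {b : I → S}
    (hb : IsBasisAlong f b) {f' : R' →+* S'} (e : R ≃+* R') (e' : S ≃+* S')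
    (h : ∀ r, e' (f r) = f' (e r)) : IsBasisAlong f' (e' ∘ b) := by
  have : (fun c : I →₀ R' ↦ c.sum fun i a ↦ f' a * (e' ∘ b) i) =
      e' ∘ (fun c : I →₀ R ↦ c.sum fun i a ↦ f a * b i) ∘
        Finsupp.mapRange.addEquiv e.symm.toAddEquiv := by
    ext c
    simp only [Function.comp_apply, map_finsuppSum, map_mul, h]
    refine .trans ?_ (Finsupp.sum_mapRange_index (f := e.symm) (hf := map_zero _) (by simp)).symm
    simp
  rw [IsBasisAlong, this]
  exact e'.bijective.comp (Function.Bijective.comp hb (AddEquiv.bijective _))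

/-- A base change of a basis is a basis. -/
lemma of_isPushout {R S S' P : CommRingCat.{u}} {f : R ⟶ S} {g : R ⟶ S'} {inl : S ⟶ P}
    {inr : S' ⟶ P} (h : IsPushout f g inl inr) {b : I → S} (hb : IsBasisAlong f.hom b) :
    IsBasisAlong inr.hom fun i ↦ inl (b i) := by
  let := f.hom.toAlgebra
  let := g.hom.toAlgebra
  let := inl.hom.toAlgebra
  let := inr.hom.toAlgebra
  let := (f ≫ inl).hom.toAlgebra
  have : IsScalarTower R S P := .of_algebraMap_eq' rfl
  have : IsScalarTower R S' P := .of_algebraMap_eq' congr($(h.w).hom)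
  have h' : Algebra.IsPushout R S S' P := CommRingCat.isPushout_iff_isPushout.mp h
  obtain ⟨b, rfl⟩ := iff_exists_basis.mp hb
  exact iff_exists_basis.mpr ⟨h'.symm.out.basis b, funext fun i ↦ IsBaseChange.basis_apply b _ i⟩

end IsBasisAlong

/-! ### Characters as functions on the torus and on `T × Y` -/

section Characters

variable (k : Type u) [Field k] {N : Type u} [AddCommGroup N]
variable (Y : Over (Spec (CommRingCat.of k)))

lemma Spec_map_appTop_ΓSpecIso_inv {A B : Type u} [CommRing A] [CommRing B] (φ : A →+* B) (x : A) :
    (Spec.map (CommRingCat.ofHom φ)).appTop ((Scheme.ΓSpecIso (.of A)).inv x) =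
      (Scheme.ΓSpecIso (.of B)).inv (φ x) :=
  congr($(Scheme.ΓSpecIso_inv_naturality (CommRingCat.ofHom φ)) x).symm

variable (N) in
/-- The character `χ(m)` as a function on the torus. -/
def torusFun (m : Module.Dual ℤ N) : Γ((torus k N).left, ⊤) :=
  (Scheme.ΓSpecIso (CommRingCat.of (AddMonoidAlgebra k (Module.Dual ℤ N)))).inv
    (AddMonoidAlgebra.single m 1)

/-- The character `χ(m)` as a function on `T × Y`. -/
def torusChar (m : Module.Dual ℤ N) : Γ((torus k N ⊗ Y).left, ⊤) :=
  (fst (torus k N) Y).left.appTop (torusFun k N m)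

variable {k Y}

lemma torusFun_basis : IsBasisAlong (torus k N).hom.appTop.hom (torusFun k N) := by
  have h1 : IsBasisAlong (algebraMap k (AddMonoidAlgebra k (Module.Dual ℤ N)))
      (fun m ↦ AddMonoidAlgebra.single m 1) :=
    IsBasisAlong.iff_exists_basis.mpr ⟨AddMonoidAlgebra.basis _ k, by ext; simp⟩
  exact h1.comp_equiv (Scheme.ΓSpecIso (.of k)).commRingCatIsoToRingEquiv.symm
    (Scheme.ΓSpecIso (.of _)).commRingCatIsoToRingEquiv.symm
      fun r ↦ (Spec_map_appTop_ΓSpecIso_inv _ r).symm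

instance : IsAffine (torus k N).left := inferInstanceAs (IsAffine (Spec _))

instance [IsAffine Y.left] : IsAffine (torus k N ⊗ Y).left :=
  inferInstanceAs (IsAffine (Limits.pullback (torus k N).hom Y.hom))

/-- The functions on `T × Y` are free over those on `Y`, and the characters are a basis. -/
lemma torusChar_basis [IsAffine Y.left] :
    IsBasisAlong (snd (torus k N) Y).left.appTop.hom (torusChar k Y) :=
  have h : IsPullback (fst (torus k N) Y).left (snd (torus k N) Y).left (torus k N).hom Y.hom :=
    IsPullback.of_hasPullback _ _
  IsBasisAlong.of_isPushout (isPushout_appTop_of_isPullback h) torusFun_basis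

lemma pullbackSpecIso_hom_appTop_tmul (H A : Type u) [CommRing H] [CommRing A] [Algebra k H]
    [Algebra k A] (x : H) (y : A) :
    (pullbackSpecIso k H A).hom.appTop ((Scheme.ΓSpecIso (.of (H ⊗[k] A))).inv (x ⊗ₜ y)) =
      (Limits.pullback.fst (Spec.map (CommRingCat.ofHom (algebraMap k H)))
          (Spec.map (CommRingCat.ofHom (algebraMap k A)))).appTop
            ((Scheme.ΓSpecIso (.of H)).inv x) *
        (Limits.pullback.snd (Spec.map (CommRingCat.ofHom (algebraMap k H)))
          (Spec.map (CommRingCat.ofHom (algebraMap k A)))).appTop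
            ((Scheme.ΓSpecIso (.of A)).inv y) := by
  rw [← pullbackSpecIso_hom_fst, ← pullbackSpecIso_hom_snd, Scheme.Hom.comp_appTop,
    Scheme.Hom.comp_appTop, CommRingCat.comp_apply, CommRingCat.comp_apply,
    Spec_map_appTop_ΓSpecIso_inv, Spec_map_appTop_ΓSpecIso_inv, ← map_mul, ← map_mul]
  simp

/-- A morphism `Spec H × Spec A ⟶ Spec B` given by `ρ : B → H ⊗ A` on functions, where `ρ(b)` is a
pure tensor. -/
lemma pullbackSpecIso_comp_appTop {H A B : Type u} [CommRing H] [CommRing A] [CommRing B]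
    [Algebra k H] [Algebra k A] (ρ : B →+* H ⊗[k] A) {b : B} {x : H} {y : A}
    (h : ρ b = x ⊗ₜ y) :
    ((pullbackSpecIso k H A).hom ≫ Spec.map (CommRingCat.ofHom ρ)).appTop
        ((Scheme.ΓSpecIso (.of B)).inv b) =
      (Limits.pullback.fst (Spec.map (CommRingCat.ofHom (algebraMap k H)))
          (Spec.map (CommRingCat.ofHom (algebraMap k A)))).appTop
            ((Scheme.ΓSpecIso (.of H)).inv x) *
        (Limits.pullback.snd (Spec.map (CommRingCat.ofHom (algebraMap k H)))
          (Spec.map (CommRingCat.ofHom (algebraMap k A)))).appTop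
            ((Scheme.ΓSpecIso (.of A)).inv y) := by
  rw [Scheme.Hom.comp_appTop, CommRingCat.comp_apply, Spec_map_appTop_ΓSpecIso_inv, h,
    pullbackSpecIso_hom_appTop_tmul]

/-- Characters are multiplicative: `μ^* χ(m) = χ(m) ⊗ χ(m)`. -/
lemma mul_appTop_torusFun (m : Module.Dual ℤ N) :
    μ[torus k N].left.appTop (torusFun k N m) =
      (fst (torus k N) (torus k N)).left.appTop (torusFun k N m) *
        (snd (torus k N) (torus k N)).left.appTop (torusFun k N m) := by
  have h : μ[torus k N].left = (pullbackSpecIso k _ _).hom ≫ Spec.map (CommRingCat.ofHom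
      (Bialgebra.comulAlgHom k (AddMonoidAlgebra k (Module.Dual ℤ N)))) :=
    mul_spec_asOver_spec_left (R := CommRingCat.of k)
      (A := CommRingCat.of (AddMonoidAlgebra k (Module.Dual ℤ N)))
  rw [h]
  exact pullbackSpecIso_comp_appTop (k := k) _ (by simp)

lemma over_comp_left_appTop {S : Scheme.{u}} {X₁ X₂ X₃ : Over S} (f : X₁ ⟶ X₂) (g : X₂ ⟶ X₃)
    (x : Γ(X₃.left, ⊤)) : (f ≫ g).left.appTop x = f.left.appTop (g.left.appTop x) := by
  rw [Over.comp_left, Scheme.Hom.comp_appTop, CommRingCat.comp_apply]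

lemma mulIdHom_appTop_torusChar (m : Module.Dual ℤ N) :
    (mulIdHom (torus k N) Y).left.appTop (torusChar k Y m) =
      torusChar k (torus k N ⊗ Y) m *
        (snd (torus k N) (torus k N ⊗ Y)).left.appTop (torusChar k Y m) := by
  have h : mulIdHom (torus k N) Y ≫ fst _ _ = (torus k N) ◁ fst (torus k N) Y ≫ μ := by
    rw [mulIdHom, Category.assoc, whiskerRight_fst, ← Category.assoc]
    congr 1
    ext1 <;> simp
  rw [torusChar, torusChar, ← over_comp_left_appTop, h, over_comp_left_appTop,
    mul_appTop_torusFun, map_mul, ← over_comp_left_appTop, ← over_comp_left_appTop,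
    whiskerLeft_fst, whiskerLeft_snd, over_comp_left_appTop]

lemma idActHom_appTop_torusChar [ModObj (torus k N) Y] (m : Module.Dual ℤ N) :
    (idActHom (torus k N) Y).left.appTop (torusChar k Y m) = torusChar k (torus k N ⊗ Y) m := by
  rw [torusChar, torusChar, ← over_comp_left_appTop, idActHom, whiskerLeft_fst]

variable {σ : PointedCone ℝ (ℝ ⊗[ℤ] N)}

variable (k σ) in
/-- Elements of `k[σ_M]` as functions on `U_σ`. -/
def toricFun : CoordRing k σ ≃+* Γ((affineToric k σ).left, ⊤) :=
  (Scheme.ΓSpecIso (CommRingCat.of (CoordRing k σ))).commRingCatIsoToRingEquiv.symm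

lemma actHom_appTop_toricFun (m : dualSemigroup σ) (c : k) :
    (actHom (torus k N) (affineToric k σ)).left.appTop
        (toricFun k σ (AddMonoidAlgebra.single m c)) =
      torusChar k (affineToric k σ) m * (snd (torus k N) (affineToric k σ)).left.appTop
        (toricFun k σ (AddMonoidAlgebra.single m c)) := by
  have h1 : (AddMonoidAlgebra.single m c : CoordRing k σ) = c • AddMonoidAlgebra.single m 1 := by
    simp
  have h2 : torusCoaction k σ (AddMonoidAlgebra.single m c) =
      AddMonoidAlgebra.single (m : Module.Dual ℤ N) (1 : k) ⊗ₜ[k]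
        AddMonoidAlgebra.single m c := by
    rw [h1, map_smul, torusCoaction_single, TensorProduct.tmul_smul]
  rw [torusAction_left]
  exact pullbackSpecIso_comp_appTop (k := k) _ h2

end Characters

/-! ### Quasicoherent sheaves on affine toric varieties -/

section Toric

variable {k : Type u} [Field k] {N : Type u} [AddCommGroup N]
  {σ : PointedCone ℝ (ℝ ⊗[ℤ] N)}

lemma toric_hom_ext {E F : (affineToric k σ).left.Modules} (hE : E.IsQuasicoherent)
    {φ ψ : E ⟶ F} (h : ∀ x : Γ(E, ⊤), appTopHom φ x = appTopHom ψ x) : φ = ψ :=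
  @Spec_modules_hom_ext (.of (CoordRing k σ)) E F hE φ ψ h

lemma exists_toric_hom {E F : (affineToric k σ).left.Modules} (hE : E.IsQuasicoherent)
    (d : Γ(E, ⊤) →+ Γ(F, ⊤)) (hd : ∀ r x, d (toricFun k σ r • x) = toricFun k σ r • d x) :
    ∃ φ : E ⟶ F, ∀ x, appTopHom φ x = d x :=
  @exists_Spec_modules_hom (.of (CoordRing k σ)) E F hE d fun r x ↦ by
    obtain ⟨r, rfl⟩ := (toricFun k σ).surjective r
    exact hd r x

variable {Z : Scheme.{u}} {f : Z ⟶ (affineToric k σ).left}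

lemma toric_pullback_hom_ext {E : (affineToric k σ).left.Modules} (hE : E.IsQuasicoherent)
    {F : Z.Modules} {φ ψ : (Scheme.Modules.pullback f).obj E ⟶ F}
    (h : ∀ x, appTopHom φ (pullbackSection f E x) = appTopHom ψ (pullbackSection f E x)) : φ = ψ :=
  @pullback_hom_ext Z (.of (CoordRing k σ)) E hE f F φ ψ h

lemma exists_toric_pullback_hom {E : (affineToric k σ).left.Modules} (hE : E.IsQuasicoherent)
    {F : Z.Modules} (d : Γ(E, ⊤) →+ Γ(F, ⊤))
    (hd : ∀ r x, d (toricFun k σ r • x) = f.appTop (toricFun k σ r) • d x) :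
    ∃ φ : (Scheme.Modules.pullback f).obj E ⟶ F, ∀ x, appTopHom φ (pullbackSection f E x) = d x :=
  @exists_pullback_hom Z (.of (CoordRing k σ)) E hE f F d fun r x ↦ by
    obtain ⟨r, rfl⟩ := (toricFun k σ).surjective r
    exact hd r x

/-- The sections of `f^* E` in terms of coefficients in `Γ(E)`, for a basis of the functions on `Z`.
-/
lemma exists_coordinates [IsAffine Z] {E : (affineToric k σ).left.Modules} (hE : E.IsQuasicoherent)
    {I : Type*} {b : I → Γ(Z, ⊤)} (hb : IsBasisAlong f.appTop.hom b) :
    ∃ e : (I →₀ Γ(E, ⊤)) ≃+ Γ((Scheme.Modules.pullback f).obj E, ⊤),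
      ∀ i x, e (Finsupp.single i x) = b i • pullbackSection f E x := by
  have h := @bijective_sum_smul_pullbackSection Z _ (.of (CoordRing k σ)) E hE f I b hb
  let e : (I →₀ Γ(E, ⊤)) →+ Γ((Scheme.Modules.pullback f).obj E, ⊤) :=
    Finsupp.liftAddHom fun i ↦
      (DistribSMul.toAddMonoidHom Γ((Scheme.Modules.pullback f).obj E, ⊤) (b i)).comp
        (pullbackSection f E)
  exact ⟨AddEquiv.ofBijective e h, fun i x ↦ Finsupp.liftAddHom_apply_single _ i x⟩

instance : IsAffine (affineToric k σ).left := inferInstanceAs (IsAffine (Spec _))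

/-- The functions on `T × T × U_σ` are free over those on `U_σ`, with the products of two characters
as a basis. -/
lemma sndSnd_basis : IsBasisAlong (sndSndHom (torus k N) (affineToric k σ)).left.appTop.hom
    fun p : Module.Dual ℤ N × Module.Dual ℤ N ↦
      (snd (torus k N) (torus k N ⊗ affineToric k σ)).left.appTop
        (torusChar k (affineToric k σ) p.1) * torusChar k (torus k N ⊗ affineToric k σ) p.2 := by
  have h := (torusChar_basis (k := k) (N := N) (Y := affineToric k σ)).trans
    (torusChar_basis (k := k) (N := N) (Y := torus k N ⊗ affineToric k σ))
  rwa [← CommRingCat.hom_comp, ← Scheme.Hom.comp_appTop, ← Over.comp_left] at h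

/-- The global sections of a sheaf of modules on `U_σ`, as a module over `k[σ_M]`. -/
def sectionsModule (E : (affineToric k σ).left.Modules) : ModuleCat.{u} (CoordRing k σ) :=
  letI : Module (CoordRing k σ) Γ(E, ⊤) := Module.compHom _ (toricFun k σ).toRingHom
  ModuleCat.of (CoordRing k σ) Γ(E, ⊤)

lemma torusChar_add {Y : Over (Spec (.of k))} (m n : Module.Dual ℤ N) :
    torusChar k Y (m + n) = torusChar k Y m * torusChar k Y n := by
  have : torusFun k N (m + n) = torusFun k N m * torusFun k N n := by
    refine Eq.trans ?_ (map_mul (Scheme.ΓSpecIso (.of _)).inv.hom _ _)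
    rw [AddMonoidAlgebra.single_mul_single, mul_one]
    rfl
  rw [torusChar, this, map_mul]
  rfl

lemma torusChar_zero {Y : Over (Spec (.of k))} :
    torusChar k Y (0 : Module.Dual ℤ N) = 1 := by
  have : torusFun k N (0 : Module.Dual ℤ N) = 1 := map_one (Scheme.ΓSpecIso _).inv.hom
  rw [torusChar, this, map_one]

/-- The homogeneous elements of `k[σ_M]` are the multiples of the `χ(n)`. -/
lemma eq_zero_or_exists_single_of_mem_gradeBy {m : Module.Dual ℤ N} {a : CoordRing k σ}
    (ha : a ∈ AddMonoidAlgebra.gradeBy k (Subtype.val : dualSemigroup σ → Module.Dual ℤ N) m) :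
    a = 0 ∨ ∃ (n : dualSemigroup σ) (c : k), (n : Module.Dual ℤ N) = m ∧
      a = AddMonoidAlgebra.single n c := by
  rcases a.coeff.support.eq_empty_or_nonempty with h | ⟨n, hn⟩
  · exact .inl (AddMonoidAlgebra.ext (Finsupp.ext fun n ↦ by simpa using! congr(n ∉ $h)))
  · refine .inr ⟨n, a.coeff n, ha n hn, AddMonoidAlgebra.ext (Finsupp.ext fun n' ↦ ?_)⟩
    by_cases h : n' = n
    · simp [h]
    · have : n' ∉ a.coeff.support := fun h' ↦ h (Subtype.ext ((ha n' h').trans (ha n hn).symm))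
      simpa [Ne.symm h] using this

section Linearization

open scoped Classical in
/-- A grading of `Γ(E)` by `M` that is compatible with the grading of `k[σ_M]` gives an isomorphism
`Φ : a^* E ≅ p^* E` for which the elements of degree `m` have weight `χ(m)`. On global sections, `Φ`
and its inverse are `a^* x ↦ χ(m) • p^* x` and `p^* x ↦ χ(-m) • a^* x` for `x` of degree `m`. -/
lemma exists_linearization {E : (affineToric k σ).left.Modules} (hE : E.IsQuasicoherent)
    {Z : Scheme.{u}} {a p : Z ⟶ (affineToric k σ).left} {χ : Module.Dual ℤ N → Γ(Z, ⊤)}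
    (hχ0 : χ 0 = 1) (hχ : ∀ m n, χ (m + n) = χ m * χ n)
    (ha : ∀ (n : dualSemigroup σ) c, a.appTop (toricFun k σ (AddMonoidAlgebra.single n c)) =
      χ n * p.appTop (toricFun k σ (AddMonoidAlgebra.single n c)))
    {𝒱 : Module.Dual ℤ N → AddSubgroup Γ(E, ⊤)} (h𝒱 : DirectSum.IsInternal 𝒱)
    (hsmul : ∀ (n : dualSemigroup σ) c m, ∀ x ∈ 𝒱 m,
      toricFun k σ (AddMonoidAlgebra.single n c) • x ∈ 𝒱 (n + m)) :
    ∃ Φ : (Scheme.Modules.pullback a).obj E ≅ (Scheme.Modules.pullback p).obj E,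
      ∀ m, ∀ x ∈ 𝒱 m, x ∈ weightSpace Φ.hom (χ m) := by
  have hinv (m) : χ m * χ (-m) = 1 := by rw [← hχ, add_neg_cancel, hχ0]
  have hinv' (m) : χ (-m) * χ m = 1 := by rw [mul_comm, hinv]
  -- semilinear maps given on homogeneous sections
  have key {f g : Z ⟶ (affineToric k σ).left} (ψ : Module.Dual ℤ N → Γ(Z, ⊤))
      (h : ∀ (n : dualSemigroup σ) c m,
        ψ (n + m) * g.appTop (toricFun k σ (AddMonoidAlgebra.single n c)) =
          f.appTop (toricFun k σ (AddMonoidAlgebra.single n c)) * ψ m) :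
      ∃ φ : (Scheme.Modules.pullback f).obj E ⟶ (Scheme.Modules.pullback g).obj E,
        ∀ m, ∀ x ∈ 𝒱 m, appTopHom φ (pullbackSection f E x) = ψ m • pullbackSection g E x := by
    obtain ⟨d, hd⟩ := h𝒱.exists_addMonoidHom fun m ↦
      (DistribSMul.toAddMonoidHom Γ((Scheme.Modules.pullback g).obj E, ⊤) (ψ m)).comp
        (pullbackSection g E)
    have hd' (m) (x) (hx : x ∈ 𝒱 m) : d x = ψ m • pullbackSection g E x := hd m x hx
    obtain ⟨φ, hφ⟩ := exists_toric_pullback_hom (f := f) hE d fun r x ↦ by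
      induction r using AddMonoidAlgebra.induction_linear with
      | zero => simp
      | add r s hr hs => rw [map_add, add_smul, map_add, hr, hs, map_add, add_smul]
      | single n c =>
        induction x using h𝒱.induction_on with
        | h0 => simp
        | hadd x y hx hy => rw [smul_add, map_add, hx, hy, map_add, smul_add]
        | hom m x hx =>
          rw [hd' _ _ (hsmul n c m x hx), hd' _ _ hx, pullbackSection_smul, smul_smul, smul_smul,
            h]
    exact ⟨φ, fun m x hx ↦ by rw [hφ, hd' m x hx]⟩
  obtain ⟨φ, hφ⟩ := key (f := a) (g := p) χ fun n c m ↦ by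
    rw [hχ, ha]
    ring
  obtain ⟨ψ, hψ⟩ := key (f := p) (g := a) (fun m ↦ χ (-m)) fun n c m ↦ by
    rw [neg_add, hχ, ha, show ∀ r s t u : Γ(Z, ⊤), r * s * (t * u) = (t * r) * (u * s) by
      intros; ring, hinv, one_mul]
  refine ⟨⟨φ, ψ, toric_pullback_hom_ext hE fun x ↦ ?_, toric_pullback_hom_ext hE fun x ↦ ?_⟩,
    fun m x hx ↦ (coactionSection_apply _ _).trans (hφ m x hx)⟩
  · rw [appTopHom_comp]
    induction x using h𝒱.induction_on with
    | h0 => simp only [map_zero]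
    | hadd x y hx hy => simp only [map_add, hx, hy]
    | hom m x hx =>
      rw [hφ m x hx, appTopHom_smul, hψ m x hx, smul_smul, hinv, one_smul]
      rfl
  · rw [appTopHom_comp]
    induction x using h𝒱.induction_on with
    | h0 => simp only [map_zero]
    | hadd x y hx hy => simp only [map_add, hx, hy]
    | hom m x hx =>
      rw [hψ m x hx, appTopHom_smul, hφ m x hx, smul_smul, hinv', one_smul]
      rfl

variable {E F : (affineToric k σ).left.Modules} {Z : Scheme.{u}}
  {a p : Z ⟶ (affineToric k σ).left}
  {χ : Module.Dual ℤ N → Γ(Z, ⊤)}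
  {Φ : (Scheme.Modules.pullback a).obj E ⟶ (Scheme.Modules.pullback p).obj E}
  {Ψ : (Scheme.Modules.pullback a).obj F ⟶ (Scheme.Modules.pullback p).obj F}

open scoped Classical in
lemma linearization_comm_of_map_mem_weightSpace (hE : E.IsQuasicoherent)
    (h𝒱 : DirectSum.IsInternal fun m ↦ weightSpace Φ (χ m)) {φ : E ⟶ F}
    (h : ∀ m, ∀ x ∈ weightSpace Φ (χ m), appTopHom φ x ∈ weightSpace Ψ (χ m)) :
    Φ ≫ (Scheme.Modules.pullback p).map φ = (Scheme.Modules.pullback a).map φ ≫ Ψ := by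
  refine toric_pullback_hom_ext hE fun x ↦ ?_
  induction x using h𝒱.induction_on with
  | h0 => simp only [map_zero]
  | hadd x y hx hy => simp only [map_add, hx, hy]
  | hom j x hx => exact linearization_comm_apply Φ hx (h j x hx)

end Linearization

lemma mulIdHom_appTop_torusChar_eq_mul (j : Module.Dual ℤ N) :
    (mulIdHom (torus k N) (affineToric k σ)).left.appTop (torusChar k (affineToric k σ) j) =
      (idActHom (torus k N) (affineToric k σ)).left.appTop (torusChar k (affineToric k σ) j) *
        (snd (torus k N) (torus k N ⊗ affineToric k σ)).left.appTop
          (torusChar k (affineToric k σ) j) := by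
  rw [mulIdHom_appTop_torusChar, idActHom_appTop_torusChar]

open scoped Classical in
lemma EquivariantQCoh.isInternal_torusWeightSpace
    (E : EquivariantQCoh (torus k N) (affineToric k σ)) :
    DirectSum.IsInternal fun m ↦ weightSpace E.Φ.hom (torusChar k (affineToric k σ) m) := by
  obtain ⟨e, he⟩ := exists_coordinates E.isQuasicoherent
    (torusChar_basis (k := k) (N := N) (Y := affineToric k σ))
  obtain ⟨e', he'⟩ := exists_coordinates E.isQuasicoherent (sndSnd_basis (k := k) (σ := σ))
  refine E.isInternal_weightSpace mulIdHom_appTop_torusChar_eq_mul e he e' fun j x ↦ ?_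
  rw [he', idActHom_appTop_torusChar]

end Toric

/-! ### Equivariant sheaves and graded modules -/

section Equivalence

variable {k : Type u} [Field k] {N : Type u} [AddCommGroup N]
  {σ : PointedCone ℝ (ℝ ⊗[ℤ] N)}

lemma toricFun_single_smul_mem_weightSpace (E : EquivariantQCoh (torus k N) (affineToric k σ))
    (n : dualSemigroup σ) (c : k) (m : Module.Dual ℤ N) {x : Γ(E.sheaf, ⊤)}
    (hx : x ∈ weightSpace E.Φ.hom (torusChar k (affineToric k σ) m)) :
    toricFun k σ (AddMonoidAlgebra.single n c) • x ∈
      weightSpace E.Φ.hom (torusChar k (affineToric k σ) (n + m)) := by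
  rw [torusChar_add]
  exact smul_mem_weightSpace _ (actHom_appTop_toricFun n c) hx

/-- The global sections of an equivariant sheaf, graded by weights. -/
def gradedSections (E : EquivariantQCoh (torus k N) (affineToric k σ)) : GradedMod k σ where
  carrier := sectionsModule E.sheaf
  component m := (weightSpace E.Φ.hom (torusChar k (affineToric k σ) m) :
    AddSubgroup Γ(E.sheaf, ⊤))
  gradedSMul := ⟨fun {m m' r x} hr hx ↦ by
    rcases eq_zero_or_exists_single_of_mem_gradeBy hr with rfl | ⟨n, c, rfl, rfl⟩
    · rw [zero_smul]
      exact zero_mem _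
    · exact toricFun_single_smul_mem_weightSpace E n c m' hx⟩
  isInternal := E.isInternal_torusWeightSpace

variable (k σ) in
/-- The functor of global sections from equivariant sheaves to graded modules. -/
def gradedSectionsFunctor : EquivariantQCoh (torus k N) (affineToric k σ) ⥤ GradedMod k σ where
  obj := gradedSections
  map {E F} f :=
    { hom := ModuleCat.ofHom (X := sectionsModule E.sheaf) (Y := sectionsModule F.sheaf)
        { toFun := appTopHom f.hom
          map_add' := map_add (appTopHom f.hom)
          map_smul' := fun r x ↦ appTopHom_smul f.hom (toricFun k σ r) x }
      map_mem := fun _ _ hx ↦ map_mem_weightSpace E.Φ.hom f.comm hx }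

instance : (gradedSectionsFunctor k σ).Faithful where
  map_injective {E _ _ _} h := EquivariantQCoh.Hom.ext <|
    toric_hom_ext E.isQuasicoherent fun x ↦ congr(($h).hom x)

instance : (gradedSectionsFunctor k σ).Full where
  map_surjective {E F} f := by
    let d : Γ(E.sheaf, ⊤) →+ Γ(F.sheaf, ⊤) := f.hom.hom.toAddMonoidHom
    obtain ⟨φ, hφ⟩ := exists_toric_hom E.isQuasicoherent d fun r x ↦ f.hom.hom.map_smul r x
    refine ⟨⟨φ, linearization_comm_of_map_mem_weightSpace E.isQuasicoherent
      E.isInternal_torusWeightSpace fun m x hx ↦ ?_⟩, ?_⟩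
    · rw [hφ]
      exact f.map_mem m x hx
    · apply GradedMod.Hom.ext
      ext x
      exact hφ x

lemma GradedMod.single_smul_mem (E : GradedMod k σ) (n : dualSemigroup σ) (c : k)
    (m : Module.Dual ℤ N) {x : E.carrier} (hx : x ∈ E.component m) :
    (AddMonoidAlgebra.single n c : CoordRing k σ) • x ∈ E.component (n + m) :=
  E.gradedSMul.smul_mem (AddMonoidAlgebra.single_mem_gradeBy _ _ _) hx

open scoped Classical in
/-- A bijective homomorphism of degree `0` is an isomorphism of graded modules. -/
def GradedMod.isoOfBijective {E F : GradedMod k σ} (f : E ⟶ F) (hf : Function.Bijective f.hom) :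
    E ≅ F where
  hom := f
  inv :=
    { hom := ModuleCat.ofHom (LinearEquiv.ofBijective f.hom.hom hf).symm.toLinearMap
      map_mem := fun m x hx ↦ by
        obtain ⟨x, rfl⟩ := hf.2 x
        refine E.isInternal.mem_of_map_mem F.isInternal f.hom.hom.toAddMonoidHom hf.1 f.map_mem ?_
        convert hx
        exact congrArg f.hom ((LinearEquiv.ofBijective f.hom.hom hf).symm_apply_apply x) }
  hom_inv_id := GradedMod.Hom.ext <| by
    ext x
    exact (LinearEquiv.ofBijective f.hom.hom hf).symm_apply_apply x
  inv_hom_id := GradedMod.Hom.ext <| by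
    ext x
    exact (LinearEquiv.ofBijective f.hom.hom hf).apply_symm_apply x

variable (k σ) in
lemma exists_toric_quasicoherent (Q : Type u) [AddCommGroup Q] [Module (CoordRing k σ) Q] :
    ∃ (T : (affineToric k σ).left.Modules) (_ : T.IsQuasicoherent) (e : Q ≃+ Γ(T, ⊤)),
      ∀ (r : CoordRing k σ) x, e (r • x) = toricFun k σ r • e x :=
  exists_quasicoherent_addEquiv (.of (CoordRing k σ)) Q

open scoped Classical in
instance : (gradedSectionsFunctor k σ).EssSurj where
  mem_essImage E := by
    obtain ⟨T, hT, e, he⟩ := exists_toric_quasicoherent k σ E.carrier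
    have hint := E.isInternal.map_addEquiv e
    obtain ⟨Φ, hΦ⟩ := exists_linearization hT (χ := torusChar k (affineToric k σ))
      torusChar_zero torusChar_add actHom_appTop_toricFun hint fun n c m x hx ↦ by
        obtain ⟨x, hx, rfl⟩ := hx
        exact ⟨_, E.single_smul_mem n c m hx, he _ _⟩
    obtain ⟨F, e', he', hF⟩ := EquivariantQCoh.exists_of_weights T hT Φ hint hΦ
      mulIdHom_appTop_torusChar_eq_mul (toric_pullback_hom_ext hT)
    let f : E ⟶ (gradedSectionsFunctor k σ).obj F :=
      { hom := ModuleCat.ofHom (Y := sectionsModule F.sheaf)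
          { toFun := fun x ↦ e' (e x)
            map_add' := fun x y ↦ by rw [map_add, map_add]; rfl
            map_smul' := fun r x ↦ by rw [he, he']; rfl }
        map_mem := fun m x hx ↦ hF m _ ⟨x, hx, rfl⟩ }
    exact ⟨F, ⟨(GradedMod.isoOfBijective f (e'.bijective.comp e.bijective)).symm⟩⟩

instance : (gradedSectionsFunctor k σ).IsEquivalence where

end Equivalence

/-! ### Graded modules and `σ`-families -/

section Families

variable {k : Type u} [Field k] {N : Type u} [AddCommGroup N] {σ : PointedCone ℝ (ℝ ⊗[ℤ] N)}

lemma CharLattice.le_add (n : dualSemigroup σ) (m : Module.Dual ℤ N) :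
    @LE.le (CharLattice σ) _ m (n + m : Module.Dual ℤ N) := by
  change (n + m : Module.Dual ℤ N) - m ∈ dualSemigroup σ
  rw [add_sub_cancel_right]
  exact n.2

namespace GradedMod

variable (E : GradedMod k σ)

/-- A graded module as a vector space over `k`. -/
instance moduleBase : Module k E.carrier :=
  Module.compHom E.carrier (algebraMap k (CoordRing k σ))

lemma base_smul_def (c : k) (x : E.carrier) :
    c • x = (AddMonoidAlgebra.single 0 c : CoordRing k σ) • x := rfl

/-- The component `E_m` as a vector space. -/
def componentSubmodule (m : Module.Dual ℤ N) : Submodule k E.carrier :=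
  { E.component m with
    smul_mem' := fun c x hx ↦ by
      have h := E.single_smul_mem 0 c m hx
      rwa [ZeroMemClass.coe_zero, zero_add] at h }

/-- Multiplication by `χ(n)`, as a map `E_m → E_m'` for `m' = n + m`. Degrees are compared by an
equation, which avoids transport between components of equal degree. -/
def step (n : dualSemigroup σ) {m m' : Module.Dual ℤ N} (h : n + m = m') :
    E.componentSubmodule m →ₗ[k] E.componentSubmodule m' where
  toFun x := ⟨(AddMonoidAlgebra.single n 1 : CoordRing k σ) • (x : E.carrier),
    h ▸ E.single_smul_mem n 1 m x.2⟩
  map_add' _ _ := Subtype.ext (smul_add _ _ _)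
  map_smul' c x := Subtype.ext <| by
    simp only [RingHom.id_apply, Submodule.coe_smul, base_smul_def, smul_smul,
      AddMonoidAlgebra.single_mul_single, mul_comm]

lemma coe_step (n : dualSemigroup σ) {m m' : Module.Dual ℤ N} (h : n + m = m')
    (x : E.componentSubmodule m) : (E.step n h x : E.carrier) =
      (AddMonoidAlgebra.single n 1 : CoordRing k σ) • (x : E.carrier) := rfl

lemma step_eq_self {n : dualSemigroup σ} (hn : n = 0) {m : Module.Dual ℤ N} (h : n + m = m)
    (x : E.componentSubmodule m) : E.step n h x = x := by
  subst hn
  exact Subtype.ext (one_smul (CoordRing k σ) (x : E.carrier))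

lemma step_step {n n' n'' : dualSemigroup σ} (hn : n'' = n' + n) {m m' m'' : Module.Dual ℤ N}
    (h : n + m = m') (h' : n' + m' = m'') (h'' : n'' + m = m'') (x : E.componentSubmodule m) :
    E.step n' h' (E.step n h x) = E.step n'' h'' x := by
  subst hn
  refine Subtype.ext ?_
  rw [coe_step, coe_step, coe_step, smul_smul, AddMonoidAlgebra.single_mul_single, one_mul]

/-- The `σ`-family of the components of a graded module; for `m ≤_σ m'` the map `E_m → E_m'` is the
multiplication by `χ(m' - m)`. -/
def toSigmaFamily : SigmaFamily k σ where
  obj m := ModuleCat.of k (E.componentSubmodule m)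
  map {m m'} f := ModuleCat.ofHom (E.step ⟨m' - m, leOfHom f⟩ (sub_add_cancel _ _))
  map_id m := by
    ext x
    exact congrArg Subtype.val (E.step_eq_self (m := m) (Subtype.ext (sub_self _))
      (sub_add_cancel _ _) x)
  map_comp {m m' m''} f g := by
    ext x
    exact congrArg Subtype.val
      (E.step_step (m := m) (m' := m') (m'' := m'')
        (Subtype.ext (sub_add_sub_cancel m'' m' m).symm) (sub_add_cancel _ _)
        (sub_add_cancel _ _) (sub_add_cancel _ _) x).symm

variable {E} {F : GradedMod k σ}

/-- The restriction `E_m → F_m` of a homomorphism of degree `0`. -/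
def Hom.restrict (f : E ⟶ F) (m : Module.Dual ℤ N) :
    E.componentSubmodule m →ₗ[k] F.componentSubmodule m where
  toFun x := ⟨f.hom x, f.map_mem m x x.2⟩
  map_add' _ _ := Subtype.ext (map_add f.hom.hom _ _)
  map_smul' c x := Subtype.ext (map_smul f.hom.hom (AddMonoidAlgebra.single 0 c) (x : E.carrier))

end GradedMod

variable (k σ) in
/-- The functor from graded modules to `σ`-families that takes a module to its components. -/
def sigmaFamilyFunctor : GradedMod k σ ⥤ SigmaFamily k σ where
  obj E := E.toSigmaFamily
  map {E F} f :=
    { app := fun m ↦ ModuleCat.ofHom (GradedMod.Hom.restrict f m)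
      naturality := fun m m' g ↦ by
        ext x
        exact Subtype.ext (map_smul f.hom.hom _ _) }

open scoped Classical in
instance : (sigmaFamilyFunctor k σ).Faithful where
  map_injective {E F _ _} h := GradedMod.Hom.ext <| by
    ext x
    induction x using E.isInternal.induction_on with
    | h0 => rw [map_zero, map_zero]
    | hadd x y hx hy => rw [map_add, map_add, hx, hy]
    | hom m x hx => exact congr(((($h).app m).hom ⟨x, hx⟩ : F.componentSubmodule m).1)

open scoped Classical in
instance : (sigmaFamilyFunctor k σ).Full where
  map_surjective {E F} φ := by
    obtain ⟨φ', hφ'⟩ : ∃ φ' : ∀ m : Module.Dual ℤ N,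
        E.componentSubmodule m →ₗ[k] F.componentSubmodule m, ∀ m, φ' m = (φ.app m).hom :=
      ⟨fun m ↦ (φ.app m).hom, fun _ ↦ rfl⟩
    -- naturality of `φ`, as compatibility with the action of the characters
    have hφ (n : dualSemigroup σ) (m : Module.Dual ℤ N) (x : E.componentSubmodule m) :
        φ' (n + m) (E.step n rfl x) = F.step n rfl (φ' m x) := by
      have hE (E : GradedMod k σ) (x : E.componentSubmodule m) :
          (E.toSigmaFamily.map (homOfLE (CharLattice.le_add n m))).hom x = E.step n rfl x :=
        Subtype.ext (congrArg (fun n ↦ (AddMonoidAlgebra.single n 1 : CoordRing k σ) •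
          (x : E.carrier)) (Subtype.ext (add_sub_cancel_right _ _)))
      rw [hφ', hφ', ← hE, ← hE]
      exact congr(($(φ.naturality (homOfLE (CharLattice.le_add n m)))).hom x)
    obtain ⟨d, hd⟩ := E.isInternal.exists_addMonoidHom_of_components fun m ↦
      ((F.componentSubmodule m).subtype ∘ₗ φ' m).toAddMonoidHom
    have hd' (m) (x : E.componentSubmodule m) : d x = (φ' m x : F.carrier) := hd m x
    have hsmul (r : CoordRing k σ) (x : E.carrier) : d (r • x) = r • d x := by
      induction r using AddMonoidAlgebra.induction_linear with
      | zero => simp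
      | add r s hr hs => rw [add_smul, map_add, hr, hs, add_smul]
      | single n c =>
        induction x using E.isInternal.induction_on with
        | h0 => simp
        | hadd x y hx hy => rw [smul_add, map_add, hx, hy, map_add, smul_add]
        | hom m x hx =>
          have h1 : (AddMonoidAlgebra.single n c : CoordRing k σ) =
              AddMonoidAlgebra.single n 1 * AddMonoidAlgebra.single 0 c := by
            rw [AddMonoidAlgebra.single_mul_single, add_zero, one_mul]
          have h2 := hd' _ (E.step n rfl (c • ⟨x, hx⟩))
          rw [h1, mul_smul, mul_smul]
          rw [hφ, (φ' m).map_smul, F.coe_step, Submodule.coe_smul, ← hd'] at h2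
          exact h2
    refine ⟨⟨ModuleCat.ofHom { d with map_smul' := hsmul }, fun m x hx ↦ ?_⟩, ?_⟩
    · exact Eq.subst (motive := (· ∈ F.component m)) (hd' m ⟨x, hx⟩).symm (φ' m ⟨x, hx⟩).2
    · ext m x
      exact Subtype.ext ((hd' m x).trans (congrArg (fun f ↦ (f x : F.carrier)) (hφ' m)))

namespace SigmaFamily

variable (F : SigmaFamily k σ)

/-- The component `F_m` of a `σ`-family, for `m` in the lattice `M` without its preorder. -/
def component (m : Module.Dual ℤ N) : ModuleCat k := F.obj m

/-- The structure map `F_m → F_m'` for `m' = n + m`. -/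
def step (n : dualSemigroup σ) {m m' : Module.Dual ℤ N} (h : n + m = m') :
    F.component m →ₗ[k] F.component m' :=
  (F.map (homOfLE (h ▸ CharLattice.le_add n m : @LE.le (CharLattice σ) _ m m'))).hom

lemma step_zero {m : Module.Dual ℤ N} (h : (0 : dualSemigroup σ) + m = m) (x : F.component m) :
    F.step 0 h x = x := congr(($(F.map_id m)).hom x)

lemma step_step (n n' : dualSemigroup σ) {m m' m'' : Module.Dual ℤ N}
    (h : n + m = m') (h' : n' + m' = m'') (h'' : ((n' + n : dualSemigroup σ) : Module.Dual ℤ N) +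
      m = m'') (x : F.component m) : F.step n' h' (F.step n h x) = F.step (n' + n) h'' x :=
  congr(($(F.map_comp (homOfLE _) (homOfLE _))).hom x).symm

/-- The direct sum `⨁ F_m` of the components of a `σ`-family. -/
abbrev Total : Type u := DirectSum (Module.Dual ℤ N) fun m ↦ F.component m

open scoped Classical in
/-- The inclusion `F_m → ⨁ F_m` of a component. -/
def incl (m : Module.Dual ℤ N) : F.component m →ₗ[k] F.Total :=
  DirectSum.lof k (Module.Dual ℤ N) (fun m ↦ F.component m) m

open scoped Classical in
/-- The action of `χ(n)` on `⨁ F_m`, by the structure maps `F_m → F_(n + m)`. -/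
def charEnd (n : dualSemigroup σ) : Module.End k F.Total :=
  DirectSum.toModule k _ _ fun m ↦ F.incl (n + m) ∘ₗ F.step n rfl

lemma total_hom_ext {W : Type*} [AddCommGroup W] [Module k W] {f g : F.Total →ₗ[k] W}
    (h : ∀ m x, f (F.incl m x) = g (F.incl m x)) : f = g := by
  classical exact DirectSum.linearMap_ext k fun m ↦ LinearMap.ext (h m)

open scoped Classical in
lemma charEnd_incl (n : dualSemigroup σ) {m m' : Module.Dual ℤ N} (h : n + m = m')
    (x : F.component m) : F.charEnd n (F.incl m x) = F.incl m' (F.step n h x) := by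
  subst h
  exact DirectSum.toModule_lof (M := fun m ↦ F.component m) k m x

lemma charEnd_zero : F.charEnd 0 = 1 :=
  F.total_hom_ext fun m x ↦ by
    rw [F.charEnd_incl 0 (zero_add m), step_zero]
    rfl

lemma charEnd_add (n n' : dualSemigroup σ) : F.charEnd (n + n') = F.charEnd n * F.charEnd n' :=
  F.total_hom_ext fun m x ↦ by
    rw [Module.End.mul_apply, F.charEnd_incl n' rfl, F.charEnd_incl n rfl,
      F.charEnd_incl (n + n') (add_assoc _ _ _), F.step_step]

/-- The action of `k[σ_M]` on `⨁ F_m`. -/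
def coordRingEnd : CoordRing k σ →ₐ[k] Module.End k F.Total :=
  AddMonoidAlgebra.lift k _ (dualSemigroup σ)
    { toFun := fun n ↦ F.charEnd n.toAdd
      map_one' := F.charEnd_zero
      map_mul' := fun n n' ↦ F.charEnd_add n.toAdd n'.toAdd }

lemma coordRingEnd_single_incl (n : dualSemigroup σ) (c : k) {m m' : Module.Dual ℤ N}
    (h : n + m = m') (x : F.component m) :
    F.coordRingEnd (AddMonoidAlgebra.single n c) (F.incl m x) = F.incl m' (c • F.step n h x) := by
  rw [coordRingEnd, AddMonoidAlgebra.lift_single, LinearMap.smul_apply, map_smul]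
  exact congrArg (c • ·) (F.charEnd_incl n h x)

lemma incl_injective (m : Module.Dual ℤ N) : Function.Injective (F.incl m) :=
  by classical exact DirectSum.of_injective m

open scoped Classical in
lemma isInternal_range_incl :
    DirectSum.IsInternal fun m ↦ (F.incl m).toAddMonoidHom.range := by
  refine DirectSum.isInternal_range (fun m ↦ (F.incl m).toAddMonoidHom) ?_
  have : DirectSum.toAddMonoid (fun m ↦ (F.incl m).toAddMonoidHom) = AddMonoidHom.id F.Total :=
    DirectSum.addHom_ext fun m x ↦ DirectSum.toAddMonoid_of _ _ _
  rw [this]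
  exact Function.bijective_id

open scoped Classical in
/-- The graded module `⨁ F_m` of a `σ`-family. -/
def toGradedMod : GradedMod k σ :=
  letI : Module (CoordRing k σ) F.Total := Module.compHom F.Total F.coordRingEnd.toRingHom
  { carrier := ModuleCat.of (CoordRing k σ) F.Total
    component m := ((F.incl m).toAddMonoidHom.range : AddSubgroup F.Total)
    gradedSMul := ⟨fun {m m' r x} hr hx ↦ by
      obtain ⟨x, rfl⟩ := hx
      rcases eq_zero_or_exists_single_of_mem_gradeBy hr with rfl | ⟨n, c, rfl, rfl⟩
      · rw [zero_smul]
        exact zero_mem _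
      · exact ⟨c • F.step n rfl x, (F.coordRingEnd_single_incl n c rfl x).symm⟩⟩
    isInternal := F.isInternal_range_incl }

/-- The inclusion of `F_m` as a map to the component of degree `m` of `⨁ F_m`. -/
def componentHom (m : Module.Dual ℤ N) :
    F.component m →ₗ[k] F.toGradedMod.componentSubmodule m where
  toFun x := ⟨F.incl m x, x, rfl⟩
  map_add' x y := Subtype.ext (map_add (F.incl m) x y)
  map_smul' c x := Subtype.ext <| by
    have h := F.coordRingEnd_single_incl 0 c (zero_add m) x
    rw [step_zero] at h
    exact h.symm

lemma componentHom_bijective (m : Module.Dual ℤ N) : Function.Bijective (F.componentHom m) :=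
  ⟨fun _ _ h ↦ F.incl_injective m (congrArg Subtype.val h),
    fun ⟨_, x, hx⟩ ↦ ⟨x, Subtype.ext hx⟩⟩

/-- The isomorphism of `F_m` with the component of degree `m` of `⨁ F_m`. -/
def componentEquiv (m : Module.Dual ℤ N) :
    F.component m ≃ₗ[k] F.toGradedMod.componentSubmodule m :=
  LinearEquiv.ofBijective (F.componentHom m) (F.componentHom_bijective m)

lemma coe_componentEquiv (m : Module.Dual ℤ N) (x : F.component m) :
    (F.componentEquiv m x : F.toGradedMod.carrier) = F.incl m x := rfl

lemma componentEquiv_step (n : dualSemigroup σ) {m m' : Module.Dual ℤ N} (h : n + m = m')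
    (x : F.component m) : F.componentEquiv m' (F.step n h x) =
      F.toGradedMod.step n h (F.componentEquiv m x) := by
  refine Subtype.ext ?_
  rw [coe_componentEquiv, GradedMod.coe_step, coe_componentEquiv]
  exact ((F.coordRingEnd_single_incl n 1 h x).trans (by rw [one_smul])).symm

end SigmaFamily

instance : (sigmaFamilyFunctor k σ).EssSurj where
  mem_essImage F :=
    ⟨F.toGradedMod, ⟨(NatIso.ofComponents (F := F) (G := F.toGradedMod.toSigmaFamily)
      (fun m ↦ (F.componentEquiv m).toModuleIso) fun {m m'} f ↦ by
        ext x
        exact F.componentEquiv_step ⟨m' - m, leOfHom f⟩ (sub_add_cancel _ _) x).symm⟩⟩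

instance : (sigmaFamilyFunctor k σ).IsEquivalence where

end Families

end

theorem mainTheorem4 {k : Type u} [Field k] [IsAlgClosed k]
    {N : Type u} [AddCommGroup N] [Module.Free ℤ N] [Module.Finite ℤ N]
    (σ : PointedCone ℝ (ℝ ⊗[ℤ] N)) (hσ : IsToricCone σ) :
    Nonempty (EquivariantQCoh (torus k N) (affineToric k σ) ≌ GradedMod k σ) ∧
      Nonempty (GradedMod k σ ≌ SigmaFamily k σ) ∧
      Nonempty (EquivariantQCoh (torus k N) (affineToric k σ) ≌ SigmaFamily k σ) :=
  ⟨⟨(gradedSectionsFunctor k σ).asEquivalence⟩, ⟨(sigmaFamilyFunctor k σ).asEquivalence⟩,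
    ⟨(gradedSectionsFunctor k σ).asEquivalence.trans (sigmaFamilyFunctor k σ).asEquivalence⟩⟩
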